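/- Let $n,m\in\mathbb R$, let $k\ge 1$ be an integer, $R>0$ and $0<\epsilon\le 1$. Write $H^k=W^{k,2}(\mathbb R)$; functions $\phi$ with $\phi-1\in H^k$ are identified with their continuous representatives. For $\phi>0$ with $\phi-1\in H^k$ let $L_\phi u=-(\phi^n u_z)_z+\phi^m u$, and let $L_\phi^{-1}[-(\phi^n)_z]$ denote the weak solution $u\in H^1$ of $L_\phi u=-(\phi^n)_z$. For $T>0$ let $$\mathcal X_{R,\epsilon,T}^k=\Big\{\phi:\ \phi-1\in C^1([0,T];H^k),\ \sup_t\|\phi(\cdot,t)-1\|_{H^k}\le R,\ \phi\ge\epsilon\Big\},\qquad [\phi-\psi]_k(T)=\sup_t\|\phi(\cdot,t)-\psi(\cdot,t)\|_{H^k},$$ and, for given data $\phi_0$, let $\Lambda[\phi](t)=\phi_0+\int_0^t\phi^m L_\phi^{-1}[-(\phi^n)_z]\,ds$. For $0<T\le\infty$, a *local solution on $[0,T)$ with data $\phi_0$* is a function $\phi>0$ with $\phi-1\in C^1([0,T);H^k)$ for which there is $u(\cdot,t)\in H^1$, with $\phi^m u$ a continuous curve in $H^k$, such that for all $t\in[0,T)$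 $$\phi(\cdot,t)=\phi_0+\int_0^t\phi(\cdot,s)^m u(\cdot,s)\,ds,\qquad \phi_t=\phi^m u,\qquad -(\phi^n u_z)_z+\phi^m u=-(\phi^n)_z .$$ 1. (Local existence and uniqueness.) For every $\delta>0$ there are $T_0>0$ and $\alpha<1$, depending only on $R,\epsilon,\delta,k,n,m$, such that for every $\phi_0$ with $\|\phi_0-1\|_{H^k}\le R-\delta$ and $\phi_0\ge 2\epsilon$, and every $0<T\le T_0$: the map $\Lambda$ is well defined on $\mathcal X^k_{R,\epsilon,T}$ (for every $\phi\in\mathcal X^k_{R,\epsilon,T}$ and $t\in[0,T]$ the elliptic equation has exactly one weak solution $u\in H^1$, and $\phi^m u\in H^k$), it maps $\mathcal X^k_{R,\epsilon,T}$ into itself, and $[\Lambda[\phi]-\Lambda[\psi]]_k(T)\le\alpha[\phi-\psi]_k(T)$ for $\phi,\psi\in\mathcal X^k_{R,\epsilon,T}$. It has a unique fixed point $\phi$ in $\mathcal X^k_{R,\epsilon,T}$; this $\phi$ (which thus satisfies $\phi\ge\epsilon$ and $\|\phi-1\|_{H^k}\le R$) is a local solution on $[0,T)$ with data $\phi_0$,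 and it is the only local solution on $[0,T)$ with data $\phi_0$. 2. (Continuous dependence.) There is a constant $C$, depending only on $R,\epsilon,k,n,m$, such that if $T>0$ and $\phi,\psi\in\mathcal X^k_{R,\epsilon,T}$ are local solutions on $[0,T)$ with data $\phi_0,\psi_0$, then $\|\phi(\cdot,t)-\psi(\cdot,t)\|_{H^k}\le\|\phi_0-\psi_0\|_{H^k}e^{Ct}$ for $0\le t<T$. 3. (Maximal time of existence.) For every $\phi_0$ with $\|\phi_0-1\|_{H^k}<R$ and $\phi_0\ge2\epsilon$ there are $T_{\max}\in(0,\infty]$ and a local solution $\phi$ on $[0,T_{\max})$ with data $\phi_0$ such that every local solution with data $\phi_0$ on an interval $[0,T)$ satisfies $T\le T_{\max}$ and agrees with $\phi$ on $[0,T)$; and if $T_{\max}<\infty$, then $$\lim_{t\to T_{\max}}\Big(\|\phi(\cdot,t)-1\|_{H^k}+\Big\|\frac1{\phi(\cdot,t)}\Big\|_\infty\Big)=\infty .$$ -/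

import Mathlib

open MeasureTheory Set Filter Topology
open scoped ContDiff ENNReal

noncomputable section

/-- `g` is the weak (distributional) derivative of `f` on the real line. -/
def IsWeakDeriv (f g : ℝ → ℝ) : Prop :=
  ∀ η : ℝ → ℝ, ContDiff ℝ ∞ η → HasCompactSupport η →
    ∫ z, f z * deriv η z = -∫ z, g z * η z

theorem memLp_test {η : ℝ → ℝ} (h : Continuous η) (hc : HasCompactSupport η) :
    MemLp η 2 (volume : Measure ℝ) :=
  h.memLp_of_hasCompactSupport hc

theorem integrable_lp_mul_test (f : Lp ℝ 2 (volume : Measure ℝ)) {η : ℝ → ℝ}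
    (h : Continuous η) (hc : HasCompactSupport η) :
    Integrable (fun z => f z * η z) (volume : Measure ℝ) :=
  MemLp.integrable_mul (Lp.memLp f) (memLp_test h hc)

theorem continuous_integral_lp_mul_test {η : ℝ → ℝ}
    (h : Continuous η) (hc : HasCompactSupport η) :
    Continuous (fun f : Lp ℝ 2 (volume : Measure ℝ) => ∫ z, f z * η z) := by
  have key : (fun f : Lp ℝ 2 (volume : Measure ℝ) => ∫ z, f z * η z)
      = fun f => inner ℝ ((memLp_test h hc).toLp η) f := by
    funext f
    rw [L2.inner_def]
    refine integral_congr_ae ?_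
    filter_upwards [(memLp_test h hc).coeFn_toLp] with z hz
    rw [hz]
    simp
  rw [key]
  fun_prop

/-- The Sobolev space `H^k = W^{k,2}(ℝ)` of real valued functions on the line. An element is stored
as the tuple `(f, f', …, f^(k))` of its weak derivatives in `L²`, and the norm is
`(∑_{j ≤ k} ‖f^(j)‖²_{L²})^(1/2)`. -/
def SobolevH (k : ℕ) :
    Submodule ℝ (PiLp 2 (fun _ : Fin (k + 1) => Lp ℝ 2 (volume : Measure ℝ))) where
  carrier := {v | ∀ j : Fin k, IsWeakDeriv (v j.castSucc) (v j.succ)}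
  zero_mem' := by
    intro j η hη hc
    have h0 := Lp.coeFn_zero ℝ 2 (volume : Measure ℝ)
    have e1 : ∫ z, ((0 : Lp ℝ 2 (volume : Measure ℝ)) : ℝ → ℝ) z * deriv η z = 0 := by
      rw [← integral_zero ℝ ℝ]
      refine integral_congr_ae ?_
      filter_upwards [h0] with z hz
      simp
    have e2 : ∫ z, ((0 : Lp ℝ 2 (volume : Measure ℝ)) : ℝ → ℝ) z * η z = 0 := by
      rw [← integral_zero ℝ ℝ]
      refine integral_congr_ae ?_
      filter_upwards [h0] with z hz
      simp
    simp only [PiLp.zero_apply]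
    rw [e1, e2, neg_zero]
  add_mem' := by
    intro v w hv hw j η hη hc
    have hd : Continuous (deriv η) := hη.continuous_deriv (by simp)
    have add : ∀ (a b : Lp ℝ 2 (volume : Measure ℝ)) (θ : ℝ → ℝ), Continuous θ →
        HasCompactSupport θ → ∫ z, (a + b : Lp ℝ 2 (volume : Measure ℝ)) z * θ z
          = (∫ z, a z * θ z) + ∫ z, b z * θ z := by
      intro a b θ hθ hθc
      rw [← integral_add (integrable_lp_mul_test a hθ hθc) (integrable_lp_mul_test b hθ hθc)]
      refine integral_congr_ae ?_
      filter_upwards [Lp.coeFn_add a b] with z hz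
      rw [hz, Pi.add_apply, add_mul]
    simp only [PiLp.add_apply]
    rw [add _ _ _ hd hc.deriv, add _ _ _ hη.continuous hc, hv j η hη hc, hw j η hη hc]
    ring
  smul_mem' := by
    intro c v hv j η hη hc
    have smul : ∀ (a : Lp ℝ 2 (volume : Measure ℝ)) (θ : ℝ → ℝ),
        ∫ z, (c • a : Lp ℝ 2 (volume : Measure ℝ)) z * θ z = c * ∫ z, a z * θ z := by
      intro a θ
      rw [← integral_const_mul]
      refine integral_congr_ae ?_
      filter_upwards [Lp.coeFn_smul c a] with z hz
      rw [hz, Pi.smul_apply, smul_eq_mul, mul_assoc]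
    simp only [PiLp.smul_apply]
    rw [smul, smul, hv j η hη hc]
    ring

theorem isClosed_sobolevH (k : ℕ) :
    IsClosed (SobolevH k : Set (PiLp 2 (fun _ : Fin (k + 1) => Lp ℝ 2 (volume : Measure ℝ)))) := by
  have : (SobolevH k : Set (PiLp 2 (fun _ : Fin (k + 1) => Lp ℝ 2 (volume : Measure ℝ))))
      = ⋂ (j : Fin k) (η : ℝ → ℝ) (_ : ContDiff ℝ ∞ η) (_ : HasCompactSupport η),
        {v | ∫ z, v j.castSucc z * deriv η z = -∫ z, v j.succ z * η z} := by
    ext v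
    simp only [mem_iInter]
    exact Iff.rfl
  rw [this]
  refine isClosed_iInter fun j => isClosed_iInter fun η => isClosed_iInter fun hη =>
    isClosed_iInter fun hc => ?_
  have hd : Continuous (deriv η) := hη.continuous_deriv (by simp)
  refine isClosed_eq ?_ ?_
  · exact (continuous_integral_lp_mul_test hd hc.deriv).comp
      (PiLp.continuous_apply 2 (fun _ : Fin (k + 1) => Lp ℝ 2 (volume : Measure ℝ)) j.castSucc)
  · exact ((continuous_integral_lp_mul_test hη.continuous hc).comp
      (PiLp.continuous_apply 2 (fun _ : Fin (k + 1) => Lp ℝ 2 (volume : Measure ℝ)) j.succ)).neg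

instance instCompleteSpaceSobolevH (k : ℕ) : CompleteSpace (SobolevH k) :=
  (isClosed_sobolevH k).completeSpace_coe

/-- The `j`-th weak derivative of an element of `H^k`, as a function (defined almost everywhere). -/
def weakD {k : ℕ} (w : SobolevH k) (j : Fin (k + 1)) : ℝ → ℝ :=
  fun z => (w : PiLp 2 (fun _ : Fin (k + 1) => Lp ℝ 2 (volume : Measure ℝ))) j z

/-- The function `φ = 1 + w` for `w ∈ H^k`, so that `w = φ - 1`. -/
def porosity {k : ℕ} (w : SobolevH k) : ℝ → ℝ := fun z => 1 + weakD w 0 z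

/-- `φ = 1 + w` is positive at every point; for `k ≥ 1` the class `φ` is identified, as usual, with
its continuous representative `g`. -/
def PorosityPos {k : ℕ} (w : SobolevH k) : Prop :=
  ∃ g : ℝ → ℝ, Continuous g ∧ g =ᵐ[volume] porosity w ∧ ∀ z, 0 < g z

/-- `φ = 1 + w ≥ c`. -/
def PorosityGe {k : ℕ} (c : ℝ) (w : SobolevH k) : Prop :=
  ∀ᵐ z, c ≤ porosity w z

/-- `u ∈ H¹` is a weak solution of `L_φ u = -(φ^n)_z`, where `L_φ u = -(φ^n u_z)_z + φ^m u`. -/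
def SolvesElliptic (n m : ℝ) (φ : ℝ → ℝ) (u : SobolevH 1) : Prop :=
  ∀ η : ℝ → ℝ, ContDiff ℝ ∞ η → HasCompactSupport η →
    ∫ z, (φ z ^ n * weakD u 1 z * deriv η z + φ z ^ m * weakD u 0 z * η z)
      = ∫ z, φ z ^ n * deriv η z

/-- `r ∈ H^k` is the function `φ^m u`. -/
def IsPowTimes {k : ℕ} (m : ℝ) (φ : ℝ → ℝ) (u : SobolevH 1) (r : SobolevH k) : Prop :=
  weakD r 0 =ᵐ[volume] fun z => φ z ^ m * weakD u 0 z

/-- The element `φ^m L_φ⁻¹[-(φ^n)_z]` of `H^k`, for `φ = 1 + w` (and `0` if there is no such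
element). -/
def rate (n m : ℝ) {k : ℕ} (w : SobolevH k) : SobolevH k :=
  open Classical in
  if h : ∃ r : SobolevH k, ∃ u : SobolevH 1,
      SolvesElliptic n m (porosity w) u ∧ IsPowTimes m (porosity w) u r
  then h.choose else 0

/-- The map `Λ[φ](t) = φ₀ + ∫₀ᵗ φ^m L_φ⁻¹[-(φ^n)_z] ds`, written for `w = φ - 1` and
`w₀ = φ₀ - 1`; the integral is the Bochner integral in `H^k`. -/
def Lam (n m : ℝ) {k : ℕ} (w₀ : SobolevH k) (w : ℝ → SobolevH k) : ℝ → SobolevH k :=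
  fun t => w₀ + ∫ s in (0 : ℝ)..t, rate n m (w s)

/-- The set `𝒳^k_{R,ε,T}` of all `φ = 1 + w` with `w ∈ C¹([0,T]; H^k)`, `‖φ(t) - 1‖_{H^k} ≤ R` and
`φ(t) ≥ ε` (that is, `‖1/φ(t)‖_∞ ≤ 1/ε`). Only the values of `w` on `[0,T]` matter. -/
def SpaceX (k : ℕ) (R ε T : ℝ) : Set (ℝ → SobolevH k) :=
  {w | ContDiffOn ℝ 1 w (Icc 0 T) ∧ ∀ t ∈ Icc (0 : ℝ) T, ‖w t‖ ≤ R ∧ PorosityGe ε (w t)}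

/-- The metric `sup_t ‖φ(t) - ψ(t)‖_{H^k}` of `𝒳^k_{R,ε,T}`. -/
def supDist {k : ℕ} (T : ℝ) (w v : ℝ → SobolevH k) : ℝ :=
  ⨆ t : Icc (0 : ℝ) T, ‖w t - v t‖

/-- The time interval `[0,T)`, where `T = ∞` is allowed. -/
def timeInterval (T : EReal) : Set ℝ := {t | 0 ≤ t ∧ (t : EReal) < T}

/-- `φ = 1 + w` is a solution on `[0,T)` with data `φ₀ = 1 + w₀`: `w ∈ C¹([0,T); H^k)`, `φ > 0`, and
there is `u(t) ∈ H¹` with `L_φ u = -(φ^n)_z` and `φ(t) = φ₀ + ∫₀ᵗ φ^m u ds`, the integrand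
`r = φ^m u` being a continuous curve in `H^k`. -/
def IsLocalSolution (n m : ℝ) {k : ℕ} (w₀ : SobolevH k) (T : EReal) (w : ℝ → SobolevH k) : Prop :=
  ContDiffOn ℝ 1 w (timeInterval T) ∧
  (∀ t ∈ timeInterval T, PorosityPos (w t)) ∧
  ∃ (u : ℝ → SobolevH 1) (r : ℝ → SobolevH k),
    ContinuousOn r (timeInterval T) ∧
    ∀ t ∈ timeInterval T,
      SolvesElliptic n m (porosity (w t)) (u t) ∧
      IsPowTimes m (porosity (w t)) (u t) (r t) ∧
      HasDerivWithinAt w (r t) (timeInterval T) t ∧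
      w t = w₀ + ∫ s in (0 : ℝ)..t, r s

end

open scoped NNReal

/-! With `w = φ - 1` the problem is the autonomous ODE `w' = rate n m w` in the Hilbert space `H^k`
(`isLocalSolution_iff`). Everything follows from one fact, `rate_bounds`: on `{‖w‖ ≤ R, φ ≥ ε}` the
map `rate` is bounded and Lipschitz, with constants depending only on `k, n, m, R, ε`. Local
existence is then Picard iteration, continuous dependence is Grönwall, and the maximal solution is
the union of all local ones. If the norms stayed below a bound along times tending to a finite
`Tmax`, the uniform local existence time would carry the solution past `Tmax`.

For `rate_bounds`, put `v = φ^n u_z - (φ^n - 1)`. The elliptic equation becomes `u' = φ^(-n) v -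
(φ^(-n) - 1)`, `v' = φ^m u`, a system in which the coefficients are not differentiated. Integrating
`(uv)' = A v² + b u² + f v + g u` over the line gives a coercive `L²` estimate
(`l2Bound_of_system`); reading the system as a formula for `u', v'` gains one derivative at a time
(`sobolevBound_of_system`). The difference of two solutions satisfies a system of the same kind,
forced by differences of the coefficients. Existence of `u` is Lax–Milgram.

The remaining ingredients are the algebra property of `H^k` and the fact that `φ ↦ φ^p - 1` is
bounded and locally Lipschitz in `H^k` (`mul_rpow_bound`). Since `H^1` functions on the line have
absolutely continuous representatives, product and chain rules reduce to calculus almost everywhere.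
-/

/-! ### Weak derivatives and absolutely continuous representatives -/

theorem IsWeakDeriv.congr_ae {f f' g g' : ℝ → ℝ} (h : IsWeakDeriv f g) (hf : f =ᵐ[volume] f')
    (hg : g =ᵐ[volume] g') : IsWeakDeriv f' g' := by
  intro η hη hc
  have e1 : ∫ z, f' z * deriv η z = ∫ z, f z * deriv η z := by
    refine integral_congr_ae ?_
    filter_upwards [hf] with z hz
    rw [hz]
  have e2 : ∫ z, g' z * η z = ∫ z, g z * η z := by
    refine integral_congr_ae ?_
    filter_upwards [hg] with z hz
    rw [hz]
  rw [e1, e2, h η hη hc]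

theorem integrable_mul_test {f : ℝ → ℝ} (hf : LocallyIntegrable f volume) {η : ℝ → ℝ}
    (h : Continuous η) (hc : HasCompactSupport η) : Integrable (fun z => f z * η z) := by
  simpa [mul_comm] using hf.integrable_smul_left_of_hasCompactSupport h hc

theorem continuous_deriv_test {η : ℝ → ℝ} (h : ContDiff ℝ ∞ η) : Continuous (deriv η) :=
  h.continuous_deriv (by simp)

theorem integral_deriv_test {η : ℝ → ℝ} (h : ContDiff ℝ ∞ η) (hc : HasCompactSupport η) :
    ∫ z, deriv η z = 0 :=
  integral_eq_zero_of_hasDerivAt_of_integrable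
    (fun x => (h.differentiable (by simp) x).hasDerivAt)
    ((continuous_deriv_test h).integrable_of_hasCompactSupport hc.deriv)
    (h.continuous.integrable_of_hasCompactSupport hc)

theorem isWeakDeriv_const (c : ℝ) : IsWeakDeriv (fun _ => c) 0 := by
  intro η hη hc
  simp [integral_const_mul, integral_deriv_test hη hc]

theorem IsWeakDeriv.add {f f' g g' : ℝ → ℝ} (h : IsWeakDeriv f f') (h' : IsWeakDeriv g g')
    (lf : LocallyIntegrable f) (lf' : LocallyIntegrable f') (lg : LocallyIntegrable g)
    (lg' : LocallyIntegrable g') : IsWeakDeriv (f + g) (f' + g') := by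
  intro η hη hc
  have hd := continuous_deriv_test hη
  simp only [Pi.add_apply, add_mul]
  rw [integral_add (integrable_mul_test lf hd hc.deriv) (integrable_mul_test lg hd hc.deriv),
    integral_add (integrable_mul_test lf' hη.continuous hc)
      (integrable_mul_test lg' hη.continuous hc), h η hη hc, h' η hη hc]
  ring

theorem IsWeakDeriv.const_mul {f f' : ℝ → ℝ} (h : IsWeakDeriv f f') (c : ℝ) :
    IsWeakDeriv (fun z => c * f z) (fun z => c * f' z) := by
  intro η hη hc
  simp only [mul_assoc, integral_const_mul]
  rw [h η hη hc]
  ring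

theorem IsWeakDeriv.unique {f g g' : ℝ → ℝ} (h : IsWeakDeriv f g) (h' : IsWeakDeriv f g')
    (lg : LocallyIntegrable g) (lg' : LocallyIntegrable g') : g =ᵐ[volume] g' := by
  refine ae_eq_of_integral_contDiff_smul_eq lg lg' fun η hη hc => ?_
  have := h η hη hc
  rw [h' η hη hc] at this
  simp only [smul_eq_mul, mul_comm (η _)]
  linarith

/-- `F` is locally absolutely continuous with derivative `g` almost everywhere. -/
structure HasACDeriv (F g : ℝ → ℝ) : Prop where
  ac : ∀ a b, AbsolutelyContinuousOnInterval F a b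
  ae : ∀ᵐ x, HasDerivAt F (g x) x

theorem HasACDeriv.continuous {F g : ℝ → ℝ} (h : HasACDeriv F g) : Continuous F := by
  refine continuous_iff_continuousAt.2 fun x => ?_
  refine (h.ac (x - 1) (x + 1)).continuousOn.continuousAt ?_
  rw [uIcc_of_le (by linarith)]
  exact Icc_mem_nhds (by linarith) (by linarith)

theorem HasACDeriv.integral_eq_sub {F g : ℝ → ℝ} (h : HasACDeriv F g) (a b : ℝ) :
    ∫ x in a..b, g x = F b - F a := by
  rw [← (h.ac a b).integral_deriv_eq_sub]
  refine intervalIntegral.integral_congr_ae ?_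
  filter_upwards [h.ae] with x hx _
  exact hx.deriv.symm

theorem hasACDeriv_integral {g : ℝ → ℝ} (hg : LocallyIntegrable g) (c : ℝ) :
    HasACDeriv (fun x => ∫ t in c..x, g t) g := by
  refine ⟨fun a b => ?_, ?_⟩
  · have hi : IntervalIntegrable g volume (min (min a b) c) (max (max a b) c) :=
      intervalIntegrable_iff.mpr
        ((hg.integrableOn_isCompact isCompact_uIcc).mono_set uIoc_subset_uIcc)
    have hle : min (min a b) c ≤ max (max a b) c := (min_le_right _ _).trans (le_max_right _ _)
    refine (hi.absolutelyContinuousOnInterval_intervalIntegral (c := c) ?_).mono ?_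
    · rw [uIcc_of_le hle]
      exact ⟨min_le_right _ _, le_max_right _ _⟩
    · rw [uIcc_of_le hle]
      intro x hx
      exact ⟨(min_le_left _ _).trans hx.1, hx.2.trans (le_max_left _ _)⟩
  · filter_upwards [_root_.LocallyIntegrable.ae_hasDerivAt_integral hg] with x hx
    exact hx c

theorem HasACDeriv.mul {F f G g : ℝ → ℝ} (hF : HasACDeriv F f) (hG : HasACDeriv G g) :
    HasACDeriv (F * G) (f * G + F * g) := by
  refine ⟨fun a b => (hF.ac a b).mul (hG.ac a b), ?_⟩
  filter_upwards [hF.ae, hG.ae] with x h1 h2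
  exact h1.mul h2

theorem HasACDeriv.isWeakDeriv {F g : ℝ → ℝ} (h : HasACDeriv F g) : IsWeakDeriv F g := by
  intro η hη hc
  obtain ⟨r, hr0, hr⟩ : ∃ r > 0, tsupport η ⊆ Ioo (-r) r := by
    obtain ⟨r, hr0, hr⟩ := hc.isCompact.isBounded.subset_ball_lt 0 0
    refine ⟨r, hr0, ?_⟩
    simpa [Real.ball_eq_Ioo] using hr
  have hv : ∀ x, x ∉ Ioo (-r) r → η x = 0 := fun x hx => image_eq_zero_of_notMem_tsupport
    fun h => hx (hr h)
  have hη' : ∀ a b, AbsolutelyContinuousOnInterval η a b := fun a b =>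
    (hη.of_le (by simp)).contDiffOn.absolutelyContinuousOnInterval
  have key := (h.ac (-r) r).integral_mul_deriv_eq_deriv_mul (hη' (-r) r)
  rw [hv r (by simp), hv (-r) (by simp)] at key
  have e1 : ∫ x in -r..r, F x * deriv η x = ∫ x, F x * deriv η x := by
    refine intervalIntegral.integral_eq_integral_of_support_subset fun x hx => ?_
    have : deriv η x ≠ 0 := fun h => hx (by simp [h])
    exact Ioo_subset_Ioc_self (hr (support_deriv_subset this))
  have e2 : ∫ x in -r..r, deriv F x * η x = ∫ x, deriv F x * η x := by
    refine intervalIntegral.integral_eq_integral_of_support_subset fun x hx => ?_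
    have : η x ≠ 0 := fun h => hx (by simp [h])
    exact Ioo_subset_Ioc_self (hr (subset_tsupport _ this))
  have e3 : ∫ x, deriv F x * η x = ∫ x, g x * η x := by
    refine integral_congr_ae ?_
    filter_upwards [h.ae] with x hx
    rw [hx.deriv]
  rw [← e1, key, e2, e3]
  ring

/-- A test function with vanishing integral is the derivative of a test function. -/
theorem exists_test_primitive {ψ : ℝ → ℝ} (h : ContDiff ℝ ∞ ψ) (hc : HasCompactSupport ψ)
    (h0 : ∫ z, ψ z = 0) :
    ∃ η : ℝ → ℝ, ContDiff ℝ ∞ η ∧ HasCompactSupport η ∧ deriv η = ψ := by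
  obtain ⟨r, hr0, hr⟩ : ∃ r > 0, tsupport ψ ⊆ Ioo (-r) r := by
    obtain ⟨r, hr0, hr⟩ := hc.isCompact.isBounded.subset_ball_lt 0 0
    refine ⟨r, hr0, ?_⟩
    simpa [Real.ball_eq_Ioo] using hr
  have hv : ∀ x, x ∉ Ioo (-r) r → ψ x = 0 := fun x hx => image_eq_zero_of_notMem_tsupport
    fun h => hx (hr h)
  have hd : ∀ x, HasDerivAt (fun x => ∫ t in -r..x, ψ t) (ψ x) x := fun x =>
    h.continuous.integral_hasStrictDerivAt (-r) x |>.hasDerivAt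
  have hderiv : deriv (fun x => ∫ t in -r..x, ψ t) = ψ := funext fun x => (hd x).deriv
  refine ⟨fun x => ∫ t in -r..x, ψ t, ?_, ?_, hderiv⟩
  · rw [contDiff_infty_iff_deriv, hderiv]
    exact ⟨fun x => (hd x).differentiableAt, h⟩
  · refine HasCompactSupport.of_support_subset_isCompact (K := Icc (-r) r) isCompact_Icc ?_
    intro x hx
    by_contra hn
    refine hx ?_
    rcases lt_or_ge x (-r) with h1 | h1
    · refine intervalIntegral.integral_zero_ae ?_
      refine Eventually.of_forall fun t ht => hv t fun h2 => ?_
      rw [uIoc_of_ge h1.le] at ht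
      exact absurd ht.2 (not_le.2 h2.1)
    · have h2 : r < x := by
        by_contra h2
        exact hn ⟨h1, not_lt.1 h2⟩
      change ∫ t in -r..x, ψ t = 0
      rw [intervalIntegral.integral_eq_integral_of_support_subset, h0]
      intro t ht
      have := hr (subset_tsupport _ ht)
      exact ⟨this.1, this.2.le.trans h2.le⟩

theorem exists_test_integral_one : ∃ θ : ℝ → ℝ, ContDiff ℝ ∞ θ ∧ HasCompactSupport θ ∧
    ∫ z, θ z = 1 := by
  let b : ContDiffBump (0 : ℝ) := ⟨1, 2, by norm_num, by norm_num⟩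
  exact ⟨b.normed volume, b.contDiff_normed, b.hasCompactSupport_normed, b.integral_normed⟩

/-- A locally integrable function with vanishing weak derivative is constant. -/
theorem IsWeakDeriv.ae_eq_const {f : ℝ → ℝ} (lf : LocallyIntegrable f) (h : IsWeakDeriv f 0) :
    ∃ c, f =ᵐ[volume] fun _ => c := by
  obtain ⟨θ, hθ, hθc, hθ1⟩ := exists_test_integral_one
  refine ⟨∫ z, f z * θ z, ?_⟩
  refine ae_eq_of_integral_contDiff_smul_eq lf (locallyIntegrable_const _) fun ζ hζ hζc => ?_
  have hi : Integrable ζ := hζ.continuous.integrable_of_hasCompactSupport hζc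
  have hθi : Integrable θ := hθ.continuous.integrable_of_hasCompactSupport hθc
  -- Subtracting a multiple of `θ` makes the mean of `ζ` vanish, so the difference is the derivative
  -- of a test function and `f` integrates to zero against it.
  obtain ⟨η, hη, hηc, hd⟩ := exists_test_primitive
    (ψ := fun z => ζ z - (∫ y, ζ y) * θ z) (hζ.sub (contDiff_const.mul hθ))
    (hζc.sub (hθc.mul_left))
    (by rw [integral_sub hi (hθi.const_mul _), integral_const_mul, hθ1]; simp)
  have := h η hη hηc
  rw [hd] at this
  have e : ∫ z, f z * (ζ z - (∫ y, ζ y) * θ z)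
      = (∫ z, f z * ζ z) - (∫ y, ζ y) * ∫ z, f z * θ z := by
    rw [← integral_const_mul, ← integral_sub (integrable_mul_test lf hζ.continuous hζc)
      ((integrable_mul_test lf hθ.continuous hθc).const_mul _)]
    congr 1
    ext z
    ring
  simp only [Pi.zero_apply, zero_mul, integral_zero, neg_zero] at this
  rw [e] at this
  simp only [smul_eq_mul, integral_mul_const]
  simp only [mul_comm (ζ _)]
  linarith

/-- The difference of `f` and the primitive of `g` has zero weak derivative, hence is constant. This
representative turns the product rule, the chain rule and the fundamental theorem into statements
about classical derivatives almost everywhere. -/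
theorem IsWeakDeriv.exists_hasACDeriv {f g : ℝ → ℝ} (h : IsWeakDeriv f g)
    (lf : LocallyIntegrable f) (lg : LocallyIntegrable g) :
    ∃ F, HasACDeriv F g ∧ f =ᵐ[volume] F := by
  have hG := hasACDeriv_integral lg 0
  set G : ℝ → ℝ := fun x => ∫ t in (0 : ℝ)..x, g t with hGdef
  have lG : LocallyIntegrable G := hG.continuous.locallyIntegrable
  have lG' : LocallyIntegrable fun z => (-1) * G z := by
    simpa only [neg_one_mul] using! lG.neg
  have lg' : LocallyIntegrable fun z => (-1) * g z := by
    simpa only [neg_one_mul] using! lg.neg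
  have h0 : IsWeakDeriv (f + fun z => (-1) * G z) (g + fun z => (-1) * g z) :=
    h.add (hG.isWeakDeriv.const_mul (-1)) lf lg lG' lg'
  obtain ⟨c, hc⟩ := IsWeakDeriv.ae_eq_const (lf.add lG')
    (h0.congr_ae (ae_eq_refl _) (Eventually.of_forall fun z => by simp))
  refine ⟨fun z => c + G z, ⟨fun a b => ?_, ?_⟩, ?_⟩
  · have : AbsolutelyContinuousOnInterval (fun _ : ℝ => c) a b :=
      (contDiff_const (n := 1)).contDiffOn.absolutelyContinuousOnInterval
    exact this.add (hG.ac a b)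
  · filter_upwards [hG.ae] with x hx
    exact hx.const_add c
  · filter_upwards [hc] with x hx
    simp only [Pi.add_apply] at hx
    linarith

theorem IsWeakDeriv.mul {f f' g g' : ℝ → ℝ} (h : IsWeakDeriv f f') (h' : IsWeakDeriv g g')
    (lf : LocallyIntegrable f) (lf' : LocallyIntegrable f') (lg : LocallyIntegrable g)
    (lg' : LocallyIntegrable g') : IsWeakDeriv (f * g) (f' * g + f * g') := by
  obtain ⟨F, hF, hf⟩ := h.exists_hasACDeriv lf lf'
  obtain ⟨G, hG, hg⟩ := h'.exists_hasACDeriv lg lg'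
  refine (hF.mul hG).isWeakDeriv.congr_ae (hf.symm.mul hg.symm) ?_
  exact ((ae_eq_refl f').mul hg.symm).add (hf.symm.mul (ae_eq_refl g'))

theorem AbsolutelyContinuousOnInterval.comp_lipschitzOnWith {F G : ℝ → ℝ} {a b : ℝ} {K : NNReal}
    (hF : AbsolutelyContinuousOnInterval F a b) (hG : LipschitzOnWith K G (F '' uIcc a b)) :
    AbsolutelyContinuousOnInterval (fun x => G (F x)) a b := by
  rw [absolutelyContinuousOnInterval_iff] at hF ⊢
  intro ε hε
  -- Dividing by `K + 1` covers `K = 0` and makes the final inequality strict.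
  obtain ⟨δ, hδ, h⟩ := hF (ε / (K + 1)) (by positivity)
  refine ⟨δ, hδ, fun E hE hs => ?_⟩
  have h1 := h E hE hs
  calc _ ≤ ∑ i ∈ Finset.range E.1, K * dist (F (E.2 i).1) (F (E.2 i).2) := by
        refine Finset.sum_le_sum fun i hi => ?_
        exact hG.dist_le_mul _ (mem_image_of_mem _ (hE.left i hi).left) _
          (mem_image_of_mem _ (hE.left i hi).right)
    _ = K * ∑ i ∈ Finset.range E.1, dist (F (E.2 i).1) (F (E.2 i).2) := by rw [Finset.mul_sum]
    _ ≤ K * (ε / (K + 1)) := by gcongr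
    _ < (K + 1) * (ε / (K + 1)) := by gcongr; linarith
    _ = ε := by field_simp

theorem Continuous.le_of_ae_le {F : ℝ → ℝ} (hF : Continuous F) {c : ℝ} (h : ∀ᵐ z, c ≤ F z)
    (z : ℝ) : c ≤ F z := by
  have hd : Dense {z | c ≤ F z} := Measure.dense_of_ae h
  have hcl : IsClosed {z | c ≤ F z} := isClosed_le continuous_const hF
  have := hd.closure_eq ▸ mem_univ z
  rwa [hcl.closure_eq] at this

/-- On a bounded interval the representative takes values in a compact part `[ε, C]` of the positive
axis, where the power is `C¹` and hence Lipschitz; this preserves absolute continuity. -/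
theorem IsWeakDeriv.rpow {f f' : ℝ → ℝ} (h : IsWeakDeriv f f') (lf : LocallyIntegrable f)
    (lf' : LocallyIntegrable f') {ε : ℝ} (hε : 0 < ε) (hf : ∀ᵐ z, ε ≤ f z) (p : ℝ) :
    IsWeakDeriv (fun z => f z ^ p) (fun z => p * f z ^ (p - 1) * f' z) := by
  obtain ⟨F, hF, hfF⟩ := h.exists_hasACDeriv lf lf'
  have hpos : ∀ z, ε ≤ F z := hF.continuous.le_of_ae_le (by
    filter_upwards [hf, hfF] with z h1 h2
    rwa [← h2])
  have hder : ∀ x : ℝ, 0 < x → HasDerivAt (fun y : ℝ => y ^ p) (p * x ^ (p - 1)) x :=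
    fun x hx => Real.hasDerivAt_rpow_const (Or.inl hx.ne')
  have hG : HasACDeriv (fun z => F z ^ p) (fun z => p * F z ^ (p - 1) * f' z) := by
    refine ⟨fun a b => ?_, ?_⟩
    · obtain ⟨C, hC⟩ := (hF.ac a b).exists_bound
      have hcd : ContDiffOn ℝ 1 (fun y : ℝ => y ^ p) (Icc ε C) := fun x hx =>
        (Real.contDiffAt_rpow_const_of_ne (hε.trans_le hx.1).ne').contDiffWithinAt
      obtain ⟨K, hK⟩ := hcd.exists_lipschitzOnWith (by decide) (convex_Icc _ _) isCompact_Icc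
      refine (hF.ac a b).comp_lipschitzOnWith (G := fun y : ℝ => y ^ p) (hK.mono ?_)
      rintro _ ⟨x, hx, rfl⟩
      exact ⟨hpos x, (le_abs_self _).trans (hC x hx)⟩
    · filter_upwards [hF.ae] with x hx
      exact (hder (F x) (hε.trans_le (hpos x))).comp x hx
  refine hG.isWeakDeriv.congr_ae ?_ ?_
  · filter_upwards [hfF] with z hz
    rw [hz]
  · filter_upwards [hfF] with z hz
    rw [hz]

/-- A locally absolutely continuous function which is integrable together with its derivative
vanishes at infinity. -/
theorem HasACDeriv.tendsto_zero {F g : ℝ → ℝ} (hF : HasACDeriv F g) (hFi : Integrable F)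
    (hg : Integrable g) : Tendsto F atTop (𝓝 0) ∧ Tendsto F atBot (𝓝 0) := by
  have top : Tendsto F atTop (𝓝 (F 0 + ∫ z in Ioi 0, g z)) := by
    have := (intervalIntegral_tendsto_integral_Ioi 0 hg.integrableOn tendsto_id).const_add (F 0)
    refine this.congr fun x => ?_
    rw [hF.integral_eq_sub, id]
    ring
  have bot : Tendsto F atBot (𝓝 (F 0 - ∫ z in Iic 0, g z)) := by
    have := (intervalIntegral_tendsto_integral_Iic 0 hg.integrableOn tendsto_id).const_sub (F 0)
    refine this.congr fun x => ?_
    rw [hF.integral_eq_sub, id]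
    ring
  -- A nonzero limit `c` would keep `|F| ≥ |c|/2` on a half-line, a set of infinite measure,
  -- contradicting integrability.
  have lim0 : ∀ (l : Filter ℝ) (c : ℝ), (∀ t ∈ l, ∃ s ⊆ t, volume s = (⊤ : ℝ≥0∞)) →
      Tendsto F l (𝓝 c) → c = 0 := by
    intro l c hl hc
    by_contra hne
    have hev : ∀ᶠ x in l, |c| / 2 ≤ ‖F x‖ := by
      have := hc.norm.eventually (lt_mem_nhds (show |c| / 2 < ‖c‖ by
        rw [Real.norm_eq_abs]; linarith [abs_pos.2 hne]))
      exact this.mono fun _ h => h.le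
    obtain ⟨s, hs, hinf⟩ := hl _ hev
    have hfin := hFi.measure_norm_ge_lt_top (ε := |c| / 2) (by linarith [abs_pos.2 hne])
    have := (measure_mono hs).trans_lt hfin
    rw [hinf] at this
    exact lt_irrefl _ this
  have e1 := lim0 atTop _ (fun t ht => by
    obtain ⟨a, ha⟩ := mem_atTop_sets.1 ht
    exact ⟨Ici a, ha, Real.volume_Ici⟩) top
  have e2 := lim0 atBot _ (fun t ht => by
    obtain ⟨a, ha⟩ := mem_atBot_sets.1 ht
    exact ⟨Iic a, ha, Real.volume_Iic⟩) bot
  exact ⟨e1 ▸ top, e2 ▸ bot⟩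

/-- The weak derivative of an integrable function has vanishing integral. -/
theorem IsWeakDeriv.integral_eq_zero {f g : ℝ → ℝ} (h : IsWeakDeriv f g) (hf : Integrable f)
    (hg : Integrable g) : ∫ z, g z = 0 := by
  obtain ⟨F, hF, hfF⟩ := h.exists_hasACDeriv hf.locallyIntegrable hg.locallyIntegrable
  obtain ⟨top, bot⟩ := hF.tendsto_zero (hf.congr hfF) hg
  have h1 := intervalIntegral_tendsto_integral hg tendsto_neg_atTop_atBot tendsto_id
  have h2 : Tendsto (fun x => F x - F (-x)) atTop (𝓝 (0 - 0)) :=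
    top.sub (bot.comp tendsto_neg_atTop_atBot)
  have h3 := tendsto_nhds_unique h1 (h2.congr fun x => (hF.integral_eq_sub _ _).symm)
  simpa using h3

/-! ### Quantitative `L²` and Sobolev bounds; the algebra `H^k` -/

/-- `f` belongs to `L²(ℝ)`, with norm at most `C`. -/
def L2Bound (f : ℝ → ℝ) (C : ℝ≥0) : Prop :=
  AEStronglyMeasurable f volume ∧ eLpNorm f 2 volume ≤ C

/-- `f` belongs to `H^k`, and its weak derivatives of order at most `k` have norm at most `C`
in `L²`. -/
def SobolevBound : ℕ → (ℝ → ℝ) → ℝ≥0 → Prop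
  | 0, f, C => L2Bound f C
  | k + 1, f, C => L2Bound f C ∧ ∃ g, IsWeakDeriv f g ∧ SobolevBound k g C

namespace L2Bound

variable {f g : ℝ → ℝ} {C D : ℝ≥0}

theorem memLp (h : L2Bound f C) : MemLp f 2 volume :=
  ⟨h.1, h.2.trans_lt ENNReal.coe_lt_top⟩

theorem locallyIntegrable (h : L2Bound f C) : LocallyIntegrable f :=
  h.memLp.locallyIntegrable (by norm_num)

theorem congr_ae (h : L2Bound f C) (hfg : f =ᵐ[volume] g) : L2Bound g C :=
  ⟨h.1.congr hfg, (eLpNorm_congr_ae hfg).symm.trans_le h.2⟩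

theorem mono (h : L2Bound f C) (hCD : C ≤ D) : L2Bound f D :=
  ⟨h.1, h.2.trans (by exact_mod_cast hCD)⟩

theorem add (hf : L2Bound f C) (hg : L2Bound g D) : L2Bound (f + g) (C + D) :=
  ⟨hf.1.add hg.1, (eLpNorm_add_le hf.1 hg.1 (by norm_num)).trans (by
    push_cast
    exact add_le_add hf.2 hg.2)⟩

theorem mul_of_bound (hf : AEStronglyMeasurable f volume) (hfC : ∀ᵐ z, |f z| ≤ C)
    (hg : L2Bound g D) : L2Bound (f * g) (C * D) := by
  refine ⟨hf.mul hg.1, ?_⟩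
  have : eLpNorm (f * g) 2 volume ≤ ENNReal.ofReal C * eLpNorm g 2 volume := by
    refine eLpNorm_le_mul_eLpNorm_of_ae_le_mul ?_ 2
    filter_upwards [hfC] with z hz
    simp only [Pi.mul_apply, norm_mul, Real.norm_eq_abs]
    gcongr
  refine this.trans ?_
  rw [ENNReal.ofReal_coe_nnreal]
  push_cast
  gcongr
  exact hg.2

theorem of_abs_le_mul (hf : AEStronglyMeasurable f volume) (hg : L2Bound g D)
    (h : ∀ᵐ z, |f z| ≤ C * |g z|) : L2Bound f (C * D) := by
  refine ⟨hf, ?_⟩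
  have : eLpNorm f 2 volume ≤ ENNReal.ofReal C * eLpNorm g 2 volume :=
    eLpNorm_le_mul_eLpNorm_of_ae_le_mul h 2
  refine this.trans ?_
  rw [ENNReal.ofReal_coe_nnreal]
  push_cast
  gcongr
  exact hg.2

theorem const_mul (hf : L2Bound f C) (c : ℝ) : L2Bound (fun z => c * f z) (‖c‖₊ * C) :=
  hf.of_abs_le_mul (hf.1.const_mul c) (Eventually.of_forall fun z => by simp [abs_mul])

theorem _root_.integral_sq_eq_eLpNorm_sq (h : MemLp f 2 volume) :
    ∫ z, f z ^ 2 = (eLpNorm f 2 volume).toReal ^ 2 := by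
  rw [← Lp.norm_toLp f h, ← real_inner_self_eq_norm_sq, L2.inner_def]
  refine integral_congr_ae ?_
  filter_upwards [h.coeFn_toLp] with z hz
  rw [hz]
  simp [sq]

theorem integral_sq_le (h : L2Bound f C) : ∫ z, f z ^ 2 ≤ (C : ℝ) ^ 2 := by
  rw [integral_sq_eq_eLpNorm_sq h.memLp]
  gcongr
  exact ENNReal.toReal_le_coe_of_le_coe h.2

theorem of_integral_sq_le (h : MemLp f 2 volume) (hC : ∫ z, f z ^ 2 ≤ (C : ℝ) ^ 2) :
    L2Bound f C := by
  refine ⟨h.1, ?_⟩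
  rw [integral_sq_eq_eLpNorm_sq h] at hC
  have h1 := abs_le_of_sq_le_sq hC C.2
  rw [← ENNReal.ofReal_coe_nnreal]
  exact (ENNReal.le_ofReal_iff_toReal_le h.2.ne C.2).2 ((le_abs_self _).trans h1)

end L2Bound

namespace SobolevBound

variable {f g f' : ℝ → ℝ} {C D : ℝ≥0} {k j : ℕ}

theorem l2 (h : SobolevBound k f C) : L2Bound f C := by
  cases k with
  | zero => exact h
  | succ k => exact h.1

theorem locallyIntegrable (h : SobolevBound k f C) : LocallyIntegrable f := h.l2.locallyIntegrable

theorem congr_ae (h : SobolevBound k f C) (hfg : f =ᵐ[volume] g) : SobolevBound k g C := by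
  cases k with
  | zero => exact L2Bound.congr_ae h hfg
  | succ k =>
    obtain ⟨h1, f', h2, h3⟩ := h
    exact ⟨h1.congr_ae hfg, f', h2.congr_ae hfg (ae_eq_refl _), h3⟩

theorem mono (h : SobolevBound k f C) (hCD : C ≤ D) : SobolevBound k f D := by
  induction k generalizing f with
  | zero => exact L2Bound.mono h hCD
  | succ k ih =>
    obtain ⟨h1, f', h2, h3⟩ := h
    exact ⟨h1.mono hCD, f', h2, ih h3⟩

theorem of_le (h : SobolevBound k f C) (hj : j ≤ k) : SobolevBound j f C := by
  induction j generalizing f k with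
  | zero => exact h.l2
  | succ j ih =>
    obtain ⟨k, rfl⟩ : ∃ i, k = i + 1 := ⟨k - 1, by omega⟩
    obtain ⟨h1, f', h2, h3⟩ := h
    exact ⟨h1, f', h2, ih h3 (by omega)⟩

theorem weakDeriv (h : SobolevBound (k + 1) f C) (hd : IsWeakDeriv f f')
    (lf' : LocallyIntegrable f') : SobolevBound k f' C := by
  obtain ⟨_, g, hg, h3⟩ := h
  exact h3.congr_ae (hg.unique hd h3.locallyIntegrable lf')

theorem succ (h : L2Bound f C) (hd : IsWeakDeriv f f') (h' : SobolevBound k f' D) :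
    SobolevBound (k + 1) f (max C D) :=
  ⟨h.mono (le_max_left _ _), f', hd, h'.mono (le_max_right _ _)⟩

theorem add (hf : SobolevBound k f C) (hg : SobolevBound k g D) :
    SobolevBound k (f + g) (C + D) := by
  induction k generalizing f g with
  | zero => exact L2Bound.add hf hg
  | succ k ih =>
    obtain ⟨h1, f', h2, h3⟩ := hf
    obtain ⟨h1', g', h2', h3'⟩ := hg
    exact ⟨h1.add h1', f' + g', h2.add h2' h1.locallyIntegrable h3.locallyIntegrable
      h1'.locallyIntegrable h3'.locallyIntegrable, ih h3 h3'⟩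

theorem const_mul (hf : SobolevBound k f C) (c : ℝ) :
    SobolevBound k (fun z => c * f z) (‖c‖₊ * C) := by
  induction k generalizing f with
  | zero => exact L2Bound.const_mul hf c
  | succ k ih =>
    obtain ⟨h1, f', h2, h3⟩ := hf
    exact ⟨h1.const_mul c, _, h2.const_mul c, ih h3⟩

theorem sub (hf : SobolevBound k f C) (hg : SobolevBound k g D) :
    SobolevBound k (f - g) (C + D) := by
  have := hf.add (hg.const_mul (-1))
  simp only [nnnorm_neg, nnnorm_one, one_mul] at this
  exact this.congr_ae (Eventually.of_forall fun z => by simp [sub_eq_add_neg])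

/-- An element of `H¹` has a continuous representative, which vanishes at infinity. -/
theorem exists_continuous (h : SobolevBound 1 f C) : ∃ F, Continuous F ∧ f =ᵐ[volume] F ∧
    (∀ z, |F z| ≤ 2 * C) ∧ Tendsto F atTop (𝓝 0) ∧ Tendsto F atBot (𝓝 0) := by
  obtain ⟨h1, f', h2, h3⟩ := h
  replace h3 : L2Bound f' C := h3
  obtain ⟨F, hF, hfF⟩ := h2.exists_hasACDeriv h1.locallyIntegrable h3.locallyIntegrable
  have hFb := h1.congr_ae hfF
  have hsq := hF.mul hF
  have i1 : Integrable (F * F) := hFb.memLp.integrable_mul hFb.memLp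
  have i2 : Integrable (f' * F + F * f') :=
    (h3.memLp.integrable_mul hFb.memLp).add (hFb.memLp.integrable_mul h3.memLp)
  obtain ⟨top, bot⟩ := hsq.tendsto_zero i1 i2
  have aux : ∀ l : Filter ℝ, Tendsto (F * F) l (𝓝 0) → Tendsto F l (𝓝 0) := by
    intro l hl
    have := (Real.continuous_sqrt.tendsto 0).comp hl
    rw [Real.sqrt_zero] at this
    refine (tendsto_zero_iff_abs_tendsto_zero F).2 (this.congr fun x => ?_)
    simp [Real.sqrt_mul_self_eq_abs]
  refine ⟨F, hF.continuous, hfF, fun z => ?_, aux _ top, aux _ bot⟩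
  -- Here `2|Ff'| ≤ F² + f'²`, whose integral is at most `2C²`. Letting `y → -∞` gives `|F z| ≤ √2
  -- C`, rounded up to `2C`.
  have b : ∀ y, F z * F z ≤ F y * F y + 2 * (C : ℝ) ^ 2 := by
    intro y
    have e := hsq.integral_eq_sub y z
    have e2 : |∫ x in y..z, (f' * F + F * f') x| ≤ ∫ x, (F x ^ 2 + f' x ^ 2) := by
      rw [← Real.norm_eq_abs]
      refine intervalIntegral.norm_integral_le_integral_norm_uIoc.trans ?_
      refine (setIntegral_le_integral i2.norm (Eventually.of_forall fun x => norm_nonneg _)).trans ?_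
      refine integral_mono i2.norm (hFb.memLp.integrable_sq.add h3.memLp.integrable_sq) fun x => ?_
      simp only [Pi.add_apply, Pi.mul_apply, Real.norm_eq_abs]
      rw [_root_.abs_le]
      constructor <;> nlinarith [sq_nonneg (F x + f' x), sq_nonneg (F x - f' x)]
    rw [integral_add hFb.memLp.integrable_sq h3.memLp.integrable_sq] at e2
    have := hFb.integral_sq_le
    have := h3.integral_sq_le
    have := (_root_.abs_le.1 e2).2
    simp only [Pi.mul_apply] at e
    rw [e] at this
    linarith
  have b2 : F z * F z ≤ 0 + 2 * (C : ℝ) ^ 2 :=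
    ge_of_tendsto' (bot.add_const (2 * (C : ℝ) ^ 2)) b
  refine abs_le_of_sq_le_sq (b := 2 * (C : ℝ)) ?_ (by positivity)
  nlinarith [sq_nonneg (C : ℝ)]

theorem abs_le (h : SobolevBound (k + 1) f C) : ∀ᵐ z, |f z| ≤ 2 * C := by
  obtain ⟨F, _, h2, h3, _⟩ := (h.of_le (show 1 ≤ k + 1 by omega)).exists_continuous
  filter_upwards [h2] with z hz
  rw [hz]
  exact h3 z

theorem mul_l2 (hf : SobolevBound (k + 1) f C) (hg : L2Bound g D) :
    L2Bound (f * g) (2 * C * D) :=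
  L2Bound.mul_of_bound hf.l2.1 (by simpa using hf.abs_le) hg

/-- `H^k` is an algebra for `k ≥ 1`. -/
theorem mul (hf : SobolevBound (k + 1) f C) (hg : SobolevBound (k + 1) g D) :
    SobolevBound (k + 1) (f * g) (2 ^ (k + 2) * (C * D)) := by
  induction k generalizing f g with
  | zero =>
    obtain ⟨h1, f', h2, h3⟩ := id hf
    obtain ⟨h1', g', h2', h3'⟩ := id hg
    refine ⟨(hf.mul_l2 h1').mono ?_, _, h2.mul h2' h1.locallyIntegrable h3.locallyIntegrable
      h1'.locallyIntegrable h3'.locallyIntegrable, ?_⟩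
    · rw [mul_assoc]; gcongr; norm_num
    · have e1 := hg.mul_l2 h3
      rw [mul_comm g f'] at e1
      exact (e1.add (hf.mul_l2 h3')).mono (le_of_eq (by ring))
  | succ k ih =>
    obtain ⟨h1, f', h2, h3⟩ := id hf
    obtain ⟨h1', g', h2', h3'⟩ := id hg
    refine ⟨(hf.mul_l2 h1').mono ?_, _, h2.mul h2' h1.locallyIntegrable h3.locallyIntegrable
      h1'.locallyIntegrable h3'.locallyIntegrable, ?_⟩
    · rw [mul_assoc]
      gcongr
      calc (2 : ℝ≥0) = 2 ^ 1 := by norm_num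
        _ ≤ 2 ^ (k + 1 + 2) := pow_le_pow_right₀ (by norm_num) (by omega)
    -- The two terms of `f'g + fg'` double the constant once per derivative.
    · exact ((ih h3 (hg.of_le (by omega))).add (ih (hf.of_le (by omega)) h3')).mono
        (le_of_eq (by ring))

/-- The second factor may be less regular, down to `L²`; the elliptic bootstrap needs this, because
at its stage `j` only `j` derivatives of the unknowns are controlled. -/
theorem mul_of_le (hf : SobolevBound (k + 1) f C) (hg : SobolevBound j g D) (hj : j ≤ k + 1) :
    SobolevBound j (f * g) (2 ^ (k + 2) * (C * D)) := by
  cases j with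
  | zero =>
    refine (hf.mul_l2 hg).mono ?_
    rw [mul_assoc]
    gcongr
    calc (2 : ℝ≥0) = 2 ^ 1 := by norm_num
      _ ≤ 2 ^ (k + 2) := pow_le_pow_right₀ (by norm_num) (by omega)
  | succ j =>
    refine ((hf.of_le hj).mul hg).mono ?_
    gcongr
    · norm_num
    · omega

end SobolevBound

/-! ### Passage between Sobolev bounds and elements of `SobolevH` -/

section Conversion

variable {k : ℕ}

theorem l2Bound_weakD (w : SobolevH k) (j : Fin (k + 1)) : L2Bound (weakD w j) ‖w‖₊ := by
  refine ⟨Lp.aestronglyMeasurable _, ?_⟩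
  have h1 := PiLp.nnnorm_apply_le
    (w : PiLp 2 (fun _ : Fin (k + 1) => Lp ℝ 2 (volume : Measure ℝ))) j
  have h2 : eLpNorm (weakD w j) 2 volume
      = ‖(w : PiLp 2 (fun _ : Fin (k + 1) => Lp ℝ 2 (volume : Measure ℝ))) j‖₊ := by
    exact (ENNReal.coe_toNNReal (Lp.eLpNorm_ne_top _)).symm
  rw [h2]
  exact_mod_cast h1

theorem isWeakDeriv_weakD (w : SobolevH k) (j : Fin k) :
    IsWeakDeriv (weakD w j.castSucc) (weakD w j.succ) := w.2 j

theorem sobolevBound_weakD (w : SobolevH k) : SobolevBound k (weakD w 0) ‖w‖₊ := by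
  have key : ∀ i (j : Fin (k + 1)), (j : ℕ) + i = k → SobolevBound i (weakD w j) ‖w‖₊ := by
    intro i
    induction i with
    | zero => intro j _; exact l2Bound_weakD w j
    | succ i ih =>
      intro j hj
      have hjk : (j : ℕ) < k := by omega
      exact ⟨l2Bound_weakD w j, _, isWeakDeriv_weakD w ⟨j, hjk⟩, ih _ (by simp; omega)⟩
  exact key k 0 (by simp)

theorem SobolevBound.exists_derivs {f : ℝ → ℝ} {C : ℝ≥0} (h : SobolevBound k f C) :
    ∃ d : ℕ → ℝ → ℝ, d 0 = f ∧ (∀ i ≤ k, L2Bound (d i) C) ∧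
      ∀ i < k, IsWeakDeriv (d i) (d (i + 1)) := by
  induction k generalizing f with
  | zero => exact ⟨fun _ => f, rfl, fun _ _ => h, fun i hi => by omega⟩
  | succ k ih =>
    obtain ⟨h1, g, h2, h3⟩ := h
    obtain ⟨d, hd0, hd1, hd2⟩ := ih h3
    refine ⟨fun i => Nat.casesOn i f d, rfl, fun i hi => ?_, fun i hi => ?_⟩
    · cases i with
      | zero => exact h1
      | succ i => exact hd1 i (by omega)
    · cases i with
      | zero => simpa [hd0] using h2
      | succ i => exact hd2 i (by omega)

theorem SobolevBound.exists_sobolevH {f : ℝ → ℝ} {C : ℝ≥0} (h : SobolevBound k f C) :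
    ∃ w : SobolevH k, weakD w 0 =ᵐ[volume] f ∧ ‖w‖ ≤ (k + 1) * C := by
  obtain ⟨d, hd0, hd1, hd2⟩ := h.exists_derivs
  have hm : ∀ j : Fin (k + 1), MemLp (d j) 2 volume := fun j => (hd1 j (by omega)).memLp
  let v : PiLp 2 (fun _ : Fin (k + 1) => Lp ℝ 2 (volume : Measure ℝ)) :=
    WithLp.toLp 2 fun j => (hm j).toLp (d j)
  have hv : v ∈ SobolevH k := by
    intro j
    exact (hd2 j j.2).congr_ae (hm j.castSucc).coeFn_toLp.symm (hm j.succ).coeFn_toLp.symm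
  refine ⟨⟨v, hv⟩, ?_, ?_⟩
  · rw [← hd0]
    exact (hm 0).coeFn_toLp
  · change ‖v‖ ≤ _
    have hn : ∀ j, ‖v j‖ ≤ C := by
      intro j
      change ‖(hm j).toLp (d j)‖ ≤ C
      rw [Lp.norm_toLp]
      exact ENNReal.toReal_le_coe_of_le_coe (hd1 j (by omega)).2
    refine abs_le_of_sq_le_sq' ?_ (by positivity) |>.2
    rw [PiLp.norm_sq_eq_of_L2]
    calc ∑ i, ‖v i‖ ^ 2 ≤ ∑ i : Fin (k + 1), (C : ℝ) ^ 2 := by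
          gcongr with i
          exact hn i
      _ = (k + 1) * (C : ℝ) ^ 2 := by simp
      -- The sharp factor `√(k+1)` is replaced by `k + 1`.
      _ ≤ (k + 1) * (C : ℝ) ^ 2 * (k + 1) := by
          refine le_mul_of_one_le_right (by positivity) ?_
          linarith [(Nat.cast_nonneg k : (0 : ℝ) ≤ k)]
      _ = ((k + 1) * C) ^ 2 := by ring

/-- Weak derivatives are unique almost everywhere, so the zeroth component determines the whole
tuple. -/
theorem SobolevH.ext_ae {w v : SobolevH k} (h : weakD w 0 =ᵐ[volume] weakD v 0) : w = v := by
  have key : ∀ i (hi : i < k + 1), weakD w ⟨i, hi⟩ =ᵐ[volume] weakD v ⟨i, hi⟩ := by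
    intro i
    induction i with
    | zero => intro hi; exact h
    | succ i ih =>
      intro hi
      have h1 := isWeakDeriv_weakD w ⟨i, by omega⟩
      have h2 := isWeakDeriv_weakD v ⟨i, by omega⟩
      exact (h1.congr_ae (ih (by omega)) (ae_eq_refl _)).unique h2
        (l2Bound_weakD w _).locallyIntegrable (l2Bound_weakD v _).locallyIntegrable
  refine Subtype.ext (PiLp.ext fun j => ?_)
  exact Lp.ext (key j j.2)

theorem weakD_sub (w v : SobolevH k) (j : Fin (k + 1)) :
    weakD (w - v) j =ᵐ[volume] weakD w j - weakD v j :=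
  Lp.coeFn_sub _ _

theorem norm_le_of_sobolevBound {w : SobolevH k} {C : ℝ≥0} (h : SobolevBound k (weakD w 0) C) :
    ‖w‖ ≤ (k + 1) * C := by
  obtain ⟨v, hv, hn⟩ := h.exists_sobolevH
  rwa [← SobolevH.ext_ae hv]

end Conversion

/-! ### Real powers of `1 + f` in Sobolev spaces -/

theorem rpow_bounds (p : ℝ) {a b : ℝ} (ha : 0 < a) :
    ∃ B L : ℝ≥0, (∀ x ∈ Icc a b, |x ^ p| ≤ B) ∧
      ∀ x ∈ Icc a b, ∀ y ∈ Icc a b, |x ^ p - y ^ p| ≤ L * |x - y| := by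
  have hcd : ContDiffOn ℝ 1 (fun y : ℝ => y ^ p) (Icc a b) := fun x hx =>
    (Real.contDiffAt_rpow_const_of_ne (ha.trans_le hx.1).ne').contDiffWithinAt
  obtain ⟨K, hK⟩ := hcd.exists_lipschitzOnWith (by decide) (convex_Icc _ _) isCompact_Icc
  obtain ⟨B, hB⟩ := isCompact_Icc.exists_bound_of_continuousOn hcd.continuousOn
  refine ⟨B.toNNReal, K, fun x hx => (hB x hx).trans (Real.le_coe_toNNReal B), fun x hx y hy => ?_⟩
  exact hK.dist_le_mul x hx y hy

/-- Since `1 + f → 1` at infinity, a lower bound for it cannot exceed `1`. Hence `1` lies in the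
interval `[ε, 1 + 2C]` on which the powers are Lipschitz. -/
theorem SobolevBound.le_one_of_ae_le_one_add {f : ℝ → ℝ} {k : ℕ} {C : ℝ≥0} (h : SobolevBound (k + 1) f C)
    {ε : ℝ} (hf : ∀ᵐ z, ε ≤ 1 + f z) : ε ≤ 1 := by
  obtain ⟨F, hc, hF, _, top, _⟩ := (h.of_le (show 1 ≤ k + 1 by omega)).exists_continuous
  have h1 : ∀ z, ε ≤ 1 + F z := (continuous_const.add hc).le_of_ae_le (by
    filter_upwards [hf, hF] with z h1 h2
    simpa [← h2] using h1)
  simpa using ge_of_tendsto' (top.const_add 1) h1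

theorem SobolevBound.ae_mem_Icc {f : ℝ → ℝ} {k : ℕ} {C : ℝ≥0} (h : SobolevBound (k + 1) f C)
    {ε : ℝ} (hf : ∀ᵐ z, ε ≤ 1 + f z) : ∀ᵐ z, 1 + f z ∈ Icc ε (1 + 2 * C) := by
  filter_upwards [hf, h.abs_le] with z h1 h2
  exact ⟨h1, by linarith [(le_abs_self (f z)).trans h2]⟩

theorem SobolevBound.aestronglyMeasurable_one_add_rpow {f : ℝ → ℝ} {k : ℕ} {C : ℝ≥0}
    (h : SobolevBound k f C) (p : ℝ) :
    AEStronglyMeasurable (fun z => (1 + f z) ^ p) volume :=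
  ((h.l2.1.aemeasurable.const_add 1).pow_const p).aestronglyMeasurable

theorem SobolevBound.locallyIntegrable_one_add_rpow {f : ℝ → ℝ} {k : ℕ} {C : ℝ≥0}
    (h : SobolevBound (k + 1) f C) {ε : ℝ} (hε : 0 < ε) (hf : ∀ᵐ z, ε ≤ 1 + f z) (p : ℝ) :
    LocallyIntegrable (fun z => (1 + f z) ^ p) volume := by
  obtain ⟨B, _, hB, _⟩ := rpow_bounds p (b := 1 + 2 * C) hε
  refine (locallyIntegrable_const (B : ℝ)).mono (h.aestronglyMeasurable_one_add_rpow p) ?_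
  filter_upwards [h.ae_mem_Icc hf] with z hz
  simpa using hB _ hz

theorem SobolevBound.exists_weakDeriv_one_add_rpow {f : ℝ → ℝ} {k : ℕ} {C : ℝ≥0}
    (h : SobolevBound (k + 1) f C) {ε : ℝ} (hε : 0 < ε) (hf : ∀ᵐ z, ε ≤ 1 + f z) :
    ∃ f', IsWeakDeriv f f' ∧ SobolevBound k f' C ∧ ∀ p : ℝ,
      IsWeakDeriv (fun z => (1 + f z) ^ p) (fun z => p * ((1 + f z) ^ (p - 1) * f' z)) := by
  obtain ⟨h1, f', h2, h3⟩ := id h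
  refine ⟨f', h2, h3, fun p => ?_⟩
  have hc := (isWeakDeriv_const 1).add h2 (locallyIntegrable_const _)
    (locallyIntegrable_const (0 : ℝ)) h1.locallyIntegrable h3.locallyIntegrable
  have hr := (hc.congr_ae (ae_eq_refl _) (g' := f') (by simp)).rpow
    ((locallyIntegrable_const _).add h1.locallyIntegrable) h3.locallyIntegrable hε hf p
  exact hr.congr_ae (ae_eq_refl _) (Eventually.of_forall fun z => mul_assoc _ _ _)

theorem IsWeakDeriv.sub_const {f f' : ℝ → ℝ} (h : IsWeakDeriv f f') (lf : LocallyIntegrable f)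
    (lf' : LocallyIntegrable f') (c : ℝ) : IsWeakDeriv (fun z => f z - c) f' := by
  refine (h.add (isWeakDeriv_const (-c)) lf lf' (locallyIntegrable_const _)
    (locallyIntegrable_const (0 : ℝ))).congr_ae ?_ ?_
  · exact Eventually.of_forall fun z => by simp [sub_eq_add_neg]
  · simp

theorem IsWeakDeriv.sub {f f' g g' : ℝ → ℝ} (h : IsWeakDeriv f f') (h' : IsWeakDeriv g g')
    (lf : LocallyIntegrable f) (lf' : LocallyIntegrable f') (lg : LocallyIntegrable g)
    (lg' : LocallyIntegrable g') : IsWeakDeriv (f - g) (f' - g') := by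
  have e : ∀ {u : ℝ → ℝ}, LocallyIntegrable u → LocallyIntegrable (fun z => (-1) * u z) := by
    intro u hu
    simpa only [neg_one_mul] using! hu.neg
  exact (h.add (h'.const_mul (-1)) lf lf' (e lg) (e lg')).congr_ae
    (Eventually.of_forall fun z => by simp [sub_eq_add_neg])
    (Eventually.of_forall fun z => by simp [sub_eq_add_neg])

/-- If multiplication by `(1 + f)^(p - 1)` is bounded and Lipschitz on `H^k`, then `(1 + f)^p - 1`
is bounded and Lipschitz in `H^(k+1)`. -/
theorem rpow_bound_of_mul_bound {k : ℕ} {p ε : ℝ} (hε : 0 < ε) {C K L : ℝ≥0}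
    (hK : ∀ f h D, SobolevBound (k + 1) f C → (∀ᵐ z, ε ≤ 1 + f z) → SobolevBound k h D →
      SobolevBound k (fun z => (1 + f z) ^ (p - 1) * h z) (K * D))
    (hL : ∀ f g h D E, SobolevBound (k + 1) f C → (∀ᵐ z, ε ≤ 1 + f z) →
      SobolevBound (k + 1) g C → (∀ᵐ z, ε ≤ 1 + g z) → SobolevBound (k + 1) (f - g) D →
      SobolevBound k h E →
      SobolevBound k (fun z => ((1 + f z) ^ (p - 1) - (1 + g z) ^ (p - 1)) * h z) (L * (D * E))) :
    ∃ K L : ℝ≥0,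
      (∀ f, SobolevBound (k + 1) f C → (∀ᵐ z, ε ≤ 1 + f z) →
        SobolevBound (k + 1) (fun z => (1 + f z) ^ p - 1) K) ∧
      ∀ f g D, SobolevBound (k + 1) f C → (∀ᵐ z, ε ≤ 1 + f z) →
        SobolevBound (k + 1) g C → (∀ᵐ z, ε ≤ 1 + g z) → SobolevBound (k + 1) (f - g) D →
        SobolevBound (k + 1) (fun z => (1 + f z) ^ p - (1 + g z) ^ p) (L * D) := by
  obtain ⟨B, M, hB, hM⟩ := rpow_bounds p (b := 1 + 2 * C) hε
  refine ⟨max (M * C) (‖p‖₊ * (K * C)), max M (‖p‖₊ * (K + L * C)), fun f hf hfε => ?_,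
    fun f g D hf hfε hg hgε hD => ?_⟩
  · obtain ⟨f', h2, h3, hp⟩ := hf.exists_weakDeriv_one_add_rpow hε hfε
    have hd := (hK f f' C hf hfε h3).const_mul p
    refine SobolevBound.succ ?_ ((hp p).sub_const
      (hf.locallyIntegrable_one_add_rpow hε hfε p) hd.locallyIntegrable 1) hd
    refine hf.l2.of_abs_le_mul ((hf.aestronglyMeasurable_one_add_rpow p).sub
      aestronglyMeasurable_const) ?_
    filter_upwards [hf.ae_mem_Icc hfε] with z hz
    -- Comparison with `1 ^ p = 1` gives `|(1 + f)^p - 1| ≤ M |f|`, which is what puts the left side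
    -- in `L²`.
    have := hM _ hz 1 ⟨SobolevBound.le_one_of_ae_le_one_add hf hfε, by linarith [C.2, NNReal.coe_nonneg C]⟩
    simpa using this
  · obtain ⟨f', h2, h3, hp⟩ := hf.exists_weakDeriv_one_add_rpow hε hfε
    obtain ⟨g', h2', h3', hp'⟩ := hg.exists_weakDeriv_one_add_rpow hε hgε
    have hdf := (hK f f' C hf hfε h3).const_mul p
    have hdg := (hK g g' C hg hgε h3').const_mul p
    have hD' : SobolevBound k (f' - g') D := hD.weakDeriv
      (h2.sub h2' hf.locallyIntegrable h3.locallyIntegrable hg.locallyIntegrable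
        h3'.locallyIntegrable) (h3.locallyIntegrable.sub h3'.locallyIntegrable)
    -- The derivatives differ by `p` times `(1+f)^(p-1) (f' - g') + ((1+f)^(p-1) - (1+g)^(p-1)) g'`.
    have hd : SobolevBound k _ (‖p‖₊ * (K * D + L * (D * C))) :=
      ((hK f _ D hf hfε hD').add (hL f g g' D C hf hfε hg hgε hD h3')).const_mul p
    have hmax : max M (‖p‖₊ * (K + L * C)) * D
        = max (M * D) (‖p‖₊ * (K * D + L * (D * C))) := by
      rw [max_mul_of_nonneg _ _ zero_le]
      congr 1
      ring
    rw [hmax]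
    refine SobolevBound.succ ?_ (((hp p).sub (hp' p) (hf.locallyIntegrable_one_add_rpow hε hfε p)
      hdf.locallyIntegrable (hg.locallyIntegrable_one_add_rpow hε hgε p)
      hdg.locallyIntegrable).congr_ae (ae_eq_refl _) (g' := _) ?_) hd
    · refine hD.l2.of_abs_le_mul ((hf.aestronglyMeasurable_one_add_rpow p).sub
        (hg.aestronglyMeasurable_one_add_rpow p)) ?_
      filter_upwards [hf.ae_mem_Icc hfε, hg.ae_mem_Icc hgε] with z hz hz'
      have := hM _ hz _ hz'
      simpa using this
    · refine Eventually.of_forall fun z => ?_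
      simp only [Pi.sub_apply, Pi.add_apply]
      ring

/-- Differentiating `φ^p` gives `p φ^(p-1) φ'`, so each derivative lowers the exponent by one; the
induction on `k` therefore runs over all `p` at once. At `k = 0` sup bounds suffice. Above that,
`φ^p` is not itself in `L²`, so the product is split as `(φ^p - 1) h + h`, whence the `+ 1` in the
constant. -/
theorem mul_rpow_bound (k : ℕ) (p : ℝ) {ε : ℝ} (hε : 0 < ε) (C : ℝ≥0) :
    ∃ K L : ℝ≥0, (∀ f h D, SobolevBound (k + 1) f C → (∀ᵐ z, ε ≤ 1 + f z) → SobolevBound k h D →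
      SobolevBound k (fun z => (1 + f z) ^ p * h z) (K * D)) ∧
    ∀ f g h D E, SobolevBound (k + 1) f C → (∀ᵐ z, ε ≤ 1 + f z) →
      SobolevBound (k + 1) g C → (∀ᵐ z, ε ≤ 1 + g z) → SobolevBound (k + 1) (f - g) D →
      SobolevBound k h E →
      SobolevBound k (fun z => ((1 + f z) ^ p - (1 + g z) ^ p) * h z) (L * (D * E)) := by
  induction k generalizing p with
  | zero =>
    obtain ⟨B, M, hB, hM⟩ := rpow_bounds p (b := 1 + 2 * C) hε
    refine ⟨B, M * 2, fun f h D hf hfε hh => ?_, fun f g h D E hf hfε hg hgε hD hh => ?_⟩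
    · refine L2Bound.mul_of_bound (hf.aestronglyMeasurable_one_add_rpow p) ?_ hh
      filter_upwards [hf.ae_mem_Icc hfε] with z hz
      exact hB _ hz
    · rw [show M * 2 * (D * E) = M * (2 * D) * E by ring]
      refine L2Bound.mul_of_bound ((hf.aestronglyMeasurable_one_add_rpow p).sub
        (hg.aestronglyMeasurable_one_add_rpow p)) ?_ hh
      filter_upwards [hf.ae_mem_Icc hfε, hg.ae_mem_Icc hgε, hD.abs_le] with z h1 h2 h3
      refine (hM _ h1 _ h2).trans ?_
      push_cast
      gcongr
      simpa using h3
  | succ k ih =>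
    obtain ⟨K, L, hK, hL⟩ := ih (p - 1)
    obtain ⟨K', L', hK', hL'⟩ := rpow_bound_of_mul_bound hε hK hL
    refine ⟨2 ^ (k + 2) * K' + 1, 2 ^ (k + 2) * L', fun f h D hf hfε hh => ?_,
      fun f g h D E hf hfε hg hgε hD hh => ?_⟩
    · refine ((((hK' f (hf.of_le (by omega)) hfε).mul hh).add hh).congr_ae
        (Eventually.of_forall fun z => ?_)).mono (le_of_eq (by ring))
      simp only [Pi.add_apply, Pi.mul_apply]
      ring
    · exact ((hL' f g D (hf.of_le (by omega)) hfε (hg.of_le (by omega)) hgε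
        (hD.of_le (by omega))).mul hh).mono (le_of_eq (by ring))

theorem rpow_bound (k : ℕ) (p : ℝ) {ε : ℝ} (hε : 0 < ε) (C : ℝ≥0) : ∃ K L : ℝ≥0,
      (∀ f, SobolevBound (k + 1) f C → (∀ᵐ z, ε ≤ 1 + f z) →
        SobolevBound (k + 1) (fun z => (1 + f z) ^ p - 1) K) ∧
      ∀ f g D, SobolevBound (k + 1) f C → (∀ᵐ z, ε ≤ 1 + f z) →
        SobolevBound (k + 1) g C → (∀ᵐ z, ε ≤ 1 + g z) → SobolevBound (k + 1) (f - g) D →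
        SobolevBound (k + 1) (fun z => (1 + f z) ^ p - (1 + g z) ^ p) (L * D) := by
  obtain ⟨K, L, hK, hL⟩ := mul_rpow_bound k (p - 1) hε C
  exact rpow_bound_of_mul_bound hε hK hL

/-! ### Energy and regularity estimates for first order systems -/

/-- Energy estimate for the system `u' = A v + f`, `v' = b u + g`. -/
theorem l2Bound_of_system {A b u v f g : ℝ → ℝ} {c M D U V : ℝ≥0} (hc : 0 < c)
    (hA : AEStronglyMeasurable A volume) (hb : AEStronglyMeasurable b volume)
    (hAc : ∀ᵐ z, c ≤ A z ∧ |A z| ≤ M) (hbc : ∀ᵐ z, c ≤ b z ∧ |b z| ≤ M)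
    (hu : L2Bound u U) (hv : L2Bound v V) (hf : L2Bound f D) (hg : L2Bound g D)
    (hu' : IsWeakDeriv u (A * v + f)) (hv' : IsWeakDeriv v (b * u + g)) :
    L2Bound u (2 * c⁻¹ * D) ∧ L2Bound v (2 * c⁻¹ * D) := by
  have hc' : (0 : ℝ) < c := hc
  have b1 : L2Bound (A * v + f) (M * V + D) :=
    (hv.mul_of_bound hA (hAc.mono fun _ h => h.2)).add hf
  have b2 : L2Bound (b * u + g) (M * U + D) :=
    (hu.mul_of_bound hb (hbc.mono fun _ h => h.2)).add hg
  -- `U` and `V` serve only to make `uv` and its derivative integrable; they do not enter the final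
  -- constant.
  have i1 : Integrable ((A * v + f) * v + u * (b * u + g)) :=
    (b1.memLp.integrable_mul hv.memLp).add (hu.memLp.integrable_mul b2.memLp)
  have h0 := (hu'.mul hv' hu.locallyIntegrable b1.locallyIntegrable hv.locallyIntegrable
    b2.locallyIntegrable).integral_eq_zero (hu.memLp.integrable_mul hv.memLp) i1
  have iu := hu.memLp.integrable_sq
  have iv := hv.memLp.integrable_sq
  have jf := hf.memLp.integrable_sq
  have jg := hg.memLp.integrable_sq
  have iuv : Integrable (fun z => u z ^ 2 + v z ^ 2) := iu.add iv
  have jfg : Integrable (fun z => f z ^ 2 + g z ^ 2) := jf.add jg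
  have key : ∫ z, (c / 2 * (u z ^ 2 + v z ^ 2) - (2 * (c : ℝ))⁻¹ * (f z ^ 2 + g z ^ 2)) ≤ 0 := by
    rw [← h0]
    refine integral_mono_ae ((iuv.const_mul _).sub (jfg.const_mul _)) i1 ?_
    filter_upwards [hAc, hbc] with z h1 h2
    simp only [Pi.add_apply, Pi.mul_apply]
    -- Young's inequality weighted by `c`: half of the coercive term absorbs the forcing.
    have e1 : -(f z * v z) ≤ c / 2 * v z ^ 2 + (2 * (c : ℝ))⁻¹ * f z ^ 2 := by
      have : c / 2 * v z ^ 2 + (2 * (c : ℝ))⁻¹ * f z ^ 2 + f z * v z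
          = (2 * (c : ℝ))⁻¹ * (c * v z + f z) ^ 2 := by field_simp; ring
      have h : 0 ≤ (2 * (c : ℝ))⁻¹ * (c * v z + f z) ^ 2 := by positivity
      linarith
    have e2 : -(g z * u z) ≤ c / 2 * u z ^ 2 + (2 * (c : ℝ))⁻¹ * g z ^ 2 := by
      have : c / 2 * u z ^ 2 + (2 * (c : ℝ))⁻¹ * g z ^ 2 + g z * u z
          = (2 * (c : ℝ))⁻¹ * (c * u z + g z) ^ 2 := by field_simp; ring
      have h : 0 ≤ (2 * (c : ℝ))⁻¹ * (c * u z + g z) ^ 2 := by positivity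
      linarith
    have e3 : c * v z ^ 2 ≤ A z * v z ^ 2 := by gcongr; exact h1.1
    have e4 : c * u z ^ 2 ≤ b z * u z ^ 2 := by gcongr; exact h2.1
    nlinarith
  rw [integral_sub (iuv.const_mul _) (jfg.const_mul _), integral_const_mul,
    integral_const_mul, integral_add iu iv, integral_add jf jg] at key
  have n1 : 0 ≤ ∫ z, u z ^ 2 := integral_nonneg fun z => sq_nonneg _
  have n2 : 0 ≤ ∫ z, v z ^ 2 := integral_nonneg fun z => sq_nonneg _
  have e : (∫ z, u z ^ 2) + ∫ z, v z ^ 2 ≤ (c : ℝ)⁻¹ ^ 2 * (2 * (D : ℝ) ^ 2) := by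
    have h1 : c / 2 * ((∫ z, u z ^ 2) + ∫ z, v z ^ 2) ≤ (2 * (c : ℝ))⁻¹ * (2 * (D : ℝ) ^ 2) := by
      refine (sub_nonpos.1 key).trans ?_
      gcongr
      linarith [hf.integral_sq_le, hg.integral_sq_le]
    calc _ = 2 * (c : ℝ)⁻¹ * (c / 2 * ((∫ z, u z ^ 2) + ∫ z, v z ^ 2)) := by field_simp
      _ ≤ 2 * (c : ℝ)⁻¹ * ((2 * (c : ℝ))⁻¹ * (2 * (D : ℝ) ^ 2)) := by gcongr
      _ = _ := by field_simp
  have e' : (c : ℝ)⁻¹ ^ 2 * (2 * (D : ℝ) ^ 2) ≤ ((2 * c⁻¹ * D : ℝ≥0) : ℝ) ^ 2 := by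
    push_cast
    have : 0 ≤ (c : ℝ)⁻¹ ^ 2 * (D : ℝ) ^ 2 := by positivity
    nlinarith
  exact ⟨.of_integral_sq_le hu.memLp (by linarith), .of_integral_sq_le hv.memLp (by linarith)⟩

/-- Regularity estimate for the system `u' = (1 + A) v + f`, `v' = (1 + b) u + g`. -/
theorem sobolevBound_of_system (k : ℕ) {c : ℝ≥0} (hc : 0 < c) (N : ℝ≥0) : ∃ K : ℝ≥0,
    ∀ (A b u v f g : ℝ → ℝ) (D U V : ℝ≥0), SobolevBound (k + 1) A N → SobolevBound (k + 1) b N →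
      (∀ᵐ z, c ≤ 1 + A z) → (∀ᵐ z, c ≤ 1 + b z) → L2Bound u U → L2Bound v V →
      SobolevBound (k + 1) f D → SobolevBound (k + 1) g D →
      IsWeakDeriv u ((1 + A) * v + f) → IsWeakDeriv v ((1 + b) * u + g) →
      SobolevBound (k + 1) u (K * D) ∧ SobolevBound (k + 1) v (K * D) := by
  suffices H : ∀ j ≤ k + 1, ∃ K : ℝ≥0,
    ∀ (A b u v f g : ℝ → ℝ) (D U V : ℝ≥0), SobolevBound (k + 1) A N → SobolevBound (k + 1) b N →
      (∀ᵐ z, c ≤ 1 + A z) → (∀ᵐ z, c ≤ 1 + b z) → L2Bound u U → L2Bound v V →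
      SobolevBound (k + 1) f D → SobolevBound (k + 1) g D →
      IsWeakDeriv u ((1 + A) * v + f) → IsWeakDeriv v ((1 + b) * u + g) →
      SobolevBound j u (K * D) ∧ SobolevBound j v (K * D) from H _ le_rfl
  -- Bootstrap: if `u, v` lie in `H^j` with `j ≤ k`, so do the right sides of the system, that is,
  -- `u'` and `v'`.
  intro j
  induction j with
  | zero =>
    intro _
    refine ⟨2 * c⁻¹, fun A b u v f g D U V hA hb hAc hbc hu hv hf hg hu' hv' => ?_⟩
    have aux : ∀ {B : ℝ → ℝ}, SobolevBound (k + 1) B N → (∀ᵐ z, c ≤ 1 + B z) →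
        ∀ᵐ z, (c : ℝ) ≤ (1 + B) z ∧ |(1 + B) z| ≤ (1 + 2 * N : ℝ≥0) := by
      intro B hB h
      filter_upwards [h, hB.abs_le] with z h1 h2
      refine ⟨h1, (abs_add_le _ _).trans ?_⟩
      push_cast
      simpa using h2
    exact l2Bound_of_system hc (aestronglyMeasurable_one.add hA.l2.1)
      (aestronglyMeasurable_one.add hb.l2.1) (aux hA hAc) (aux hb hbc) hu hv hf.l2 hg.l2 hu' hv'
  | succ j ih =>
    intro hj
    obtain ⟨K, hK⟩ := ih (by omega)
    refine ⟨max K (K + 2 ^ (k + 2) * (N * K) + 1),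
      fun A b u v f g D U V hA hb hAc hbc hu hv hf hg hu' hv' => ?_⟩
    obtain ⟨h1, h2⟩ := hK A b u v f g D U V hA hb hAc hbc hu hv hf hg hu' hv'
    have hm : max K (K + 2 ^ (k + 2) * (N * K) + 1) * D
        = max (K * D) (K * D + 2 ^ (k + 2) * (N * (K * D)) + D) := by
      rw [max_mul_of_nonneg _ _ zero_le]
      congr 1
      ring
    -- The coefficient `1 + B` is not in `L²`; only its part `B` is treated by the algebra estimate.
    have e : ∀ B w h : ℝ → ℝ, w + B * w + h = (1 + B) * w + h := fun B w h => by ring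
    rw [hm]
    refine ⟨SobolevBound.succ h1.l2 hu' ?_, SobolevBound.succ h2.l2 hv' ?_⟩
    · rw [← e]
      exact (h2.add (hA.mul_of_le h2 (by omega))).add (hf.of_le (by omega))
    · rw [← e]
      exact (h1.add (hb.mul_of_le h1 (by omega))).add (hg.of_le (by omega))

/-! ### Weak solutions by Lax–Milgram -/

section LaxMilgram

theorem lpPairing_holderL_eq {a : ℝ → ℝ} (ha : MemLp a ∞ (volume : Measure ℝ))
    (f g : Lp ℝ 2 (volume : Measure ℝ)) :
    (ContinuousLinearMap.mul ℝ ℝ).lpPairing volume 2 2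
      ((ContinuousLinearMap.mul ℝ ℝ).holderL volume ∞ 2 2 (ha.toLp a) f) g
      = ∫ z, a z * f z * g z := by
  rw [ContinuousLinearMap.lpPairing_eq_integral]
  refine integral_congr_ae ?_
  filter_upwards [ContinuousLinearMap.coeFn_holder (r := 2) (ContinuousLinearMap.mul ℝ ℝ)
    (ha.toLp a) f, ha.coeFn_toLp] with z h1 h2
  simp only [ContinuousLinearMap.holderL_apply_apply, ContinuousLinearMap.mul_apply'] at h1 ⊢
  rw [h1, h2]

/-- The weak derivative of order `j` as a bounded operator from `H^k` to `L²`. -/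
noncomputable def weakDL (k : ℕ) (j : Fin (k + 1)) :
    SobolevH k →L[ℝ] Lp ℝ 2 (volume : Measure ℝ) :=
  (PiLp.proj 2 (fun _ : Fin (k + 1) => Lp ℝ 2 (volume : Measure ℝ)) j).comp (SobolevH k).subtypeL

theorem coeFn_weakDL {k : ℕ} (j : Fin (k + 1)) (w : SobolevH k) :
    (weakDL k j w : ℝ → ℝ) = weakD w j := rfl

theorem norm_sq_sobolevH_one (u : SobolevH 1) :
    ‖u‖ ^ 2 = (∫ z, weakD u 0 z ^ 2) + ∫ z, weakD u 1 z ^ 2 := by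
  have h : ∀ j, ‖weakDL 1 j u‖ ^ 2 = ∫ z, weakD u j z ^ 2 := by
    intro j
    rw [← real_inner_self_eq_norm_sq, L2.inner_def]
    refine integral_congr_ae (Eventually.of_forall fun z => ?_)
    simp [sq, coeFn_weakDL]
  rw [← h, ← h]
  change ‖(u : PiLp 2 (fun _ : Fin 2 => Lp ℝ 2 (volume : Measure ℝ)))‖ ^ 2 = _
  rw [PiLp.norm_sq_eq_of_L2, Fin.sum_univ_two]
  rfl

/-- The upper bounds on `a, b` make the bilinear form continuous on `H¹`, and the lower bounds make
it coercive with constant `c`, so Lax–Milgram applies. -/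
theorem exists_weak_solution {a b h : ℝ → ℝ} {c M : ℝ≥0} (hc : 0 < c)
    (ha : AEStronglyMeasurable a volume) (hb : AEStronglyMeasurable b volume)
    (hac : ∀ᵐ z, c ≤ a z ∧ |a z| ≤ M) (hbc : ∀ᵐ z, c ≤ b z ∧ |b z| ≤ M)
    (hh : MemLp h 2 volume) :
    ∃ u : SobolevH 1, ∀ v : SobolevH 1,
      (∫ z, a z * weakD u 1 z * weakD v 1 z) + ∫ z, b z * weakD u 0 z * weakD v 0 z
        = ∫ z, h z * weakD v 1 z := by
  have hal : MemLp a ∞ volume := memLp_top_of_bound ha M (hac.mono fun _ h => h.2)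
  have hbl : MemLp b ∞ volume := memLp_top_of_bound hb M (hbc.mono fun _ h => h.2)
  let P := (ContinuousLinearMap.mul ℝ ℝ).lpPairing (volume : Measure ℝ) 2 2
  let Q := (ContinuousLinearMap.mul ℝ ℝ).holderL (volume : Measure ℝ) ∞ 2 2
  let B : SobolevH 1 →L[ℝ] SobolevH 1 →L[ℝ] ℝ :=
    P.bilinearComp ((Q (hal.toLp a)).comp (weakDL 1 1)) (weakDL 1 1)
      + P.bilinearComp ((Q (hbl.toLp b)).comp (weakDL 1 0)) (weakDL 1 0)
  have hB : ∀ u v, B u v = (∫ z, a z * weakD u 1 z * weakD v 1 z)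
      + ∫ z, b z * weakD u 0 z * weakD v 0 z := by
    intro u v
    have e1 := lpPairing_holderL_eq hal (weakDL 1 1 u) (weakDL 1 1 v)
    have e2 := lpPairing_holderL_eq hbl (weakDL 1 0 u) (weakDL 1 0 v)
    simp only [coeFn_weakDL] at e1 e2
    rw [← e1, ← e2]
    rfl
  have low : ∀ {a : ℝ → ℝ}, AEStronglyMeasurable a volume → (∀ᵐ z, c ≤ a z ∧ |a z| ≤ M) →
      ∀ (u : SobolevH 1) (j : Fin 2),
      c * ∫ z, weakD u j z ^ 2 ≤ ∫ z, a z * weakD u j z * weakD u j z := by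
    intro a ha hac u j
    have hu := l2Bound_weakD u j
    rw [← integral_const_mul]
    refine integral_mono_ae (hu.memLp.integrable_sq.const_mul _) ?_ ?_
    · exact (hu.mul_of_bound ha (hac.mono fun _ h => h.2)).memLp.integrable_mul hu.memLp
    · filter_upwards [hac] with z hz
      have := mul_le_mul_of_nonneg_right hz.1 (sq_nonneg (weakD u j z))
      simpa only [sq, mul_assoc] using this
  have hco : IsCoercive B := by
    refine ⟨c, hc, fun u => ?_⟩
    rw [mul_assoc, ← sq, norm_sq_sobolevH_one, hB]
    linarith [low ha hac u 1, low hb hbc u 0]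
  let ℓ : SobolevH 1 →L[ℝ] ℝ := (P (hh.toLp h)).comp (weakDL 1 1)
  have hl : ∀ v, ℓ v = ∫ z, h z * weakD v 1 z := by
    intro v
    change P (hh.toLp h) (weakDL 1 1 v) = _
    rw [ContinuousLinearMap.lpPairing_eq_integral]
    refine integral_congr_ae ?_
    filter_upwards [hh.coeFn_toLp] with z h2
    rw [h2]
    rfl
  refine ⟨hco.continuousLinearEquivOfBilin.symm ((InnerProductSpace.toDual ℝ _).symm ℓ),
    fun v => ?_⟩
  rw [← hB, ← hl, ← hco.continuousLinearEquivOfBilin_apply]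
  simp

end LaxMilgram

/-- Lets the variational identity over `H¹` be tested with smooth compactly supported functions, as
in `SolvesElliptic`. -/
theorem exists_sobolevH_of_test {η : ℝ → ℝ} (h : ContDiff ℝ ∞ η) (hc : HasCompactSupport η) :
    ∃ v : SobolevH 1, weakD v 0 =ᵐ[volume] η ∧ weakD v 1 =ᵐ[volume] deriv η := by
  have hd := continuous_deriv_test h
  have aux : ∀ {θ : ℝ → ℝ}, Continuous θ → HasCompactSupport θ → ∃ C, L2Bound θ C := by
    intro θ hθ hθc
    have := memLp_test hθ hθc
    exact ⟨(eLpNorm θ 2 volume).toNNReal, this.1, (ENNReal.coe_toNNReal this.2.ne).ge⟩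
  obtain ⟨C, hC⟩ := aux h.continuous hc
  obtain ⟨D, hD⟩ := aux hd hc.deriv
  have hw : IsWeakDeriv η (deriv η) := HasACDeriv.isWeakDeriv
    ⟨fun a b => (h.of_le (by simp)).contDiffOn.absolutelyContinuousOnInterval,
      Eventually.of_forall fun x => (h.differentiable (by simp) x).hasDerivAt⟩
  obtain ⟨v, hv, -⟩ := (SobolevBound.succ (k := 0) hC hw hD).exists_sobolevH
  exact ⟨v, hv, ((isWeakDeriv_weakD v 0).congr_ae hv (ae_eq_refl _)).unique hw
    (l2Bound_weakD v _).locallyIntegrable hD.locallyIntegrable⟩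

/-! ### The elliptic problem and the Lipschitz bound for `rate` -/

section Elliptic

variable {k : ℕ} {n m ε : ℝ}

theorem PorosityGe.ae_le {w : SobolevH k} (h : PorosityGe ε w) : ∀ᵐ z, ε ≤ 1 + weakD w 0 z := h

/-- An upper bound `B` for `x^(-p)` inverts to a lower bound for `x^p`; `B + 1` keeps the
denominator positive. -/
theorem exists_lower_rpow (p : ℝ) {a b : ℝ} (ha : 0 < a) :
    ∃ c : ℝ≥0, 0 < c ∧ ∀ x ∈ Icc a b, c ≤ x ^ p := by
  obtain ⟨B, _, hB, _⟩ := rpow_bounds (-p) (b := b) ha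
  refine ⟨(B + 1)⁻¹, by positivity, fun x hx => ?_⟩
  have hx0 : 0 < x := ha.trans_le hx.1
  have h1 := (le_abs_self _).trans (hB x hx)
  rw [Real.rpow_neg hx0.le] at h1
  push_cast
  rw [inv_le_comm₀ (by positivity) (Real.rpow_pos_of_pos hx0 p)]
  linarith

theorem exists_solvesElliptic {w : SobolevH (k + 1)} (hε : 0 < ε) (hw : PorosityGe ε w) :
    ∃ u : SobolevH 1, SolvesElliptic n m (porosity w) u := by
  have hb := sobolevBound_weakD w
  have hI := hb.ae_mem_Icc hw.ae_le
  have hyp : ∀ p : ℝ, ∃ c M : ℝ≥0, 0 < c ∧ ∀ᵐ z, c ≤ (1 + weakD w 0 z) ^ p ∧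
      |(1 + weakD w 0 z) ^ p| ≤ M := by
    intro p
    obtain ⟨c, hc, h1⟩ := exists_lower_rpow p (b := 1 + 2 * ‖w‖₊) hε
    obtain ⟨M, _, h2, _⟩ := rpow_bounds p (b := 1 + 2 * ‖w‖₊) hε
    exact ⟨c, M, hc, hI.mono fun z hz => ⟨h1 _ hz, h2 _ hz⟩⟩
  obtain ⟨c, M, hc, h1⟩ := hyp n
  obtain ⟨c', M', hc', h2⟩ := hyp m
  obtain ⟨K, _, hK, _⟩ := rpow_bound k n hε ‖w‖₊
  have hh := (hK _ hb hw.ae_le).l2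
  obtain ⟨u, hu⟩ := exists_weak_solution (lt_min hc hc') (M := max M M')
    (hb.aestronglyMeasurable_one_add_rpow n) (hb.aestronglyMeasurable_one_add_rpow m)
    (h1.mono fun z h => ⟨le_trans (by exact_mod_cast min_le_left c c') h.1,
      h.2.trans (by exact_mod_cast le_max_left M M')⟩)
    (h2.mono fun z h => ⟨le_trans (by exact_mod_cast min_le_right c c') h.1,
      h.2.trans (by exact_mod_cast le_max_right M M')⟩) hh.memLp
  refine ⟨u, fun η hη hc => ?_⟩
  obtain ⟨v, hv0, hv1⟩ := exists_sobolevH_of_test hη hc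
  have hd := continuous_deriv_test hη
  have e := hu v
  have u1 := (l2Bound_weakD u 1).mul_of_bound (hb.aestronglyMeasurable_one_add_rpow n)
    (h1.mono fun _ h => h.2)
  have u0 := (l2Bound_weakD u 0).mul_of_bound (hb.aestronglyMeasurable_one_add_rpow m)
    (h2.mono fun _ h => h.2)
  have e1 : ∫ z, (1 + weakD w 0 z) ^ n * weakD u 1 z * weakD v 1 z
      = ∫ z, (1 + weakD w 0 z) ^ n * weakD u 1 z * deriv η z := by
    refine integral_congr_ae ?_
    filter_upwards [hv1] with z hz
    rw [hz]
  have e2 : ∫ z, (1 + weakD w 0 z) ^ m * weakD u 0 z * weakD v 0 z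
      = ∫ z, (1 + weakD w 0 z) ^ m * weakD u 0 z * η z := by
    refine integral_congr_ae ?_
    filter_upwards [hv0] with z hz
    rw [hz]
  -- The functional needs an `L²` density, hence `φ^n - 1` instead of `φ^n`; the constant drops out
  -- because `∫ η' = 0`.
  have e3 : ∫ z, ((1 + weakD w 0 z) ^ n - 1) * weakD v 1 z
      = ∫ z, (1 + weakD w 0 z) ^ n * deriv η z := by
    have : ∫ z, ((1 + weakD w 0 z) ^ n - 1) * weakD v 1 z
        = ∫ z, ((1 + weakD w 0 z) ^ n * deriv η z - deriv η z) := by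
      refine integral_congr_ae ?_
      filter_upwards [hv1] with z hz
      rw [hz]
      ring
    rw [this, integral_sub (integrable_mul_test
      (hb.locallyIntegrable_one_add_rpow hε hw.ae_le n) hd hc.deriv)
      (hd.integrable_of_hasCompactSupport hc.deriv), integral_deriv_test hη hc, sub_zero]
  rw [e1, e2, e3, ← integral_add
    (by exact integrable_mul_test u1.locallyIntegrable hd hc.deriv)
    (by exact integrable_mul_test u0.locallyIntegrable hη.continuous hc)] at e
  exact e

/-- The elliptic equation as a first order system. -/
theorem SolvesElliptic.system {w : SobolevH (k + 1)} (hε : 0 < ε) (hw : PorosityGe ε w)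
    {u : SobolevH 1} (h : SolvesElliptic n m (porosity w) u) :
    ∃ (v : ℝ → ℝ) (V : ℝ≥0), L2Bound v V ∧
      IsWeakDeriv (weakD u 0) ((1 + fun z => (1 + weakD w 0 z) ^ (-n) - 1) * v
        - fun z => (1 + weakD w 0 z) ^ (-n) - 1) ∧
      IsWeakDeriv v ((1 + fun z => (1 + weakD w 0 z) ^ m - 1) * weakD u 0) := by
  have hb := sobolevBound_weakD w
  have hI := hb.ae_mem_Icc hw.ae_le
  obtain ⟨M, _, hM, _⟩ := rpow_bounds n (b := 1 + 2 * ‖w‖₊) hε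
  obtain ⟨M', _, hM', _⟩ := rpow_bounds m (b := 1 + 2 * ‖w‖₊) hε
  obtain ⟨K, _, hK, _⟩ := rpow_bound k n hε ‖w‖₊
  have hh := (hK _ hb hw.ae_le).l2
  have u1 := (l2Bound_weakD u 1).mul_of_bound (hb.aestronglyMeasurable_one_add_rpow n)
    (hI.mono fun z h => hM _ h)
  have u0 := (l2Bound_weakD u 0).mul_of_bound (hb.aestronglyMeasurable_one_add_rpow m)
    (hI.mono fun z h => hM' _ h)
  -- The auxiliary unknown is `v = φ^n u_z - (φ^n - 1)`; removing the constant places it in `L²`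
  -- without changing its derivative.
  have hv := u1.add (hh.const_mul (-1))
  refine ⟨_, _, hv, ?_, ?_⟩
  · refine (isWeakDeriv_weakD u 0).congr_ae (ae_eq_refl _) ?_
    filter_upwards [hI] with z hz
    have hz0 : 0 < 1 + weakD w 0 z := hε.trans_le hz.1
    have hp := Real.rpow_pos_of_pos hz0 n
    simp only [Pi.sub_apply, Pi.mul_apply, Pi.add_apply, Pi.one_apply, Real.rpow_neg hz0.le]
    change weakD u 1 z = _
    field_simp
    ring
  · intro η hη hc
    have hd := continuous_deriv_test hη
    have j1 := integrable_mul_test u1.locallyIntegrable hd hc.deriv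
    have j0 := integrable_mul_test u0.locallyIntegrable hη.continuous hc
    have j2 := integrable_mul_test
      (hb.locallyIntegrable_one_add_rpow hε hw.ae_le n) hd hc.deriv
    have j3 := hd.integrable_of_hasCompactSupport (μ := volume) hc.deriv
    have e := h η hη hc
    have e' : (∫ z, (1 + weakD w 0 z) ^ n * weakD u 1 z * deriv η z)
        + ∫ z, (1 + weakD w 0 z) ^ m * weakD u 0 z * η z
        = ∫ z, (1 + weakD w 0 z) ^ n * deriv η z := by
      rw [← integral_add (by exact j1) (by exact j0)]
      exact e
    have e1 : ∫ z, (((fun z => (1 + weakD w 0 z) ^ n) * weakD u 1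
        + fun z => (-1) * ((1 + weakD w 0 z) ^ n - 1)) z) * deriv η z
        = (∫ z, (1 + weakD w 0 z) ^ n * weakD u 1 z * deriv η z)
          - ((∫ z, (1 + weakD w 0 z) ^ n * deriv η z) - ∫ z, deriv η z) := by
      rw [← integral_sub j2 j3, ← integral_sub (by exact j1) (by exact j2.sub j3)]
      refine integral_congr_ae (Eventually.of_forall fun z => ?_)
      simp only [Pi.mul_apply, Pi.add_apply]
      ring
    have e2 : ∫ z, ((1 + fun z => (1 + weakD w 0 z) ^ m - 1) * weakD u 0) z * η z
        = ∫ z, (1 + weakD w 0 z) ^ m * weakD u 0 z * η z := by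
      refine integral_congr_ae (Eventually.of_forall fun z => ?_)
      simp
    rw [e2]
    refine e1.trans ?_
    rw [integral_deriv_test hη hc]
    linarith

/-- Bounds for the solution of the elliptic equation and for its dependence on `φ`. -/
theorem elliptic_bounds (k : ℕ) (n m : ℝ) {ε : ℝ} (hε : 0 < ε) (C : ℝ≥0) :
    ∃ K L : ℝ≥0,
      (∀ (w : SobolevH (k + 1)) (u : SobolevH 1), ‖w‖₊ ≤ C → PorosityGe ε w →
        SolvesElliptic n m (porosity w) u →
        SobolevBound (k + 1) (fun z => porosity w z ^ m * weakD u 0 z) K) ∧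
      ∀ (w w' : SobolevH (k + 1)) (u u' : SobolevH 1), ‖w‖₊ ≤ C → PorosityGe ε w →
        ‖w'‖₊ ≤ C → PorosityGe ε w' →
        SolvesElliptic n m (porosity w) u → SolvesElliptic n m (porosity w') u' →
        SobolevBound (k + 1) (weakD u 0 - weakD u' 0) (L * ‖w - w'‖₊) ∧
        SobolevBound (k + 1) ((fun z => porosity w z ^ m * weakD u 0 z)
          - fun z => porosity w' z ^ m * weakD u' 0 z) (L * ‖w - w'‖₊) := by
  obtain ⟨N₁, L₁, hN₁, hL₁⟩ := rpow_bound k (-n) hε C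
  obtain ⟨N₂, L₂, hN₂, hL₂⟩ := rpow_bound k m hε C
  obtain ⟨c₁, hc₁, hc₁'⟩ := exists_lower_rpow (-n) (b := 1 + 2 * C) hε
  obtain ⟨c₂, hc₂, hc₂'⟩ := exists_lower_rpow m (b := 1 + 2 * C) hε
  set N := max N₁ N₂ with hN
  obtain ⟨K, hK⟩ := sobolevBound_of_system k (lt_min hc₁ hc₂) N
  have coef : ∀ w : SobolevH (k + 1), ‖w‖₊ ≤ C → PorosityGe ε w →
      SobolevBound (k + 1) (fun z => (1 + weakD w 0 z) ^ (-n) - 1) N ∧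
      SobolevBound (k + 1) (fun z => (1 + weakD w 0 z) ^ m - 1) N ∧
      (∀ᵐ z, (min c₁ c₂ : ℝ≥0) ≤ 1 + ((1 + weakD w 0 z) ^ (-n) - 1)) ∧
      ∀ᵐ z, (min c₁ c₂ : ℝ≥0) ≤ 1 + ((1 + weakD w 0 z) ^ m - 1) := by
    intro w hw hwε
    have hb := (sobolevBound_weakD w).mono hw
    have hI := hb.ae_mem_Icc hwε.ae_le
    refine ⟨(hN₁ _ hb hwε.ae_le).mono (le_max_left _ _),
      (hN₂ _ hb hwε.ae_le).mono (le_max_right _ _), ?_, ?_⟩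
    · filter_upwards [hI] with z hz
      have h1 : ((min c₁ c₂ : ℝ≥0) : ℝ) ≤ c₁ := by exact_mod_cast min_le_left c₁ c₂
      linarith [hc₁' _ hz]
    · filter_upwards [hI] with z hz
      have h1 : ((min c₁ c₂ : ℝ≥0) : ℝ) ≤ c₂ := by exact_mod_cast min_le_right c₁ c₂
      linarith [hc₂' _ hz]
  have zero : ∀ D : ℝ≥0, SobolevBound (k + 1) 0 D := fun D => by
    have h := ((sobolevBound_weakD (0 : SobolevH (k + 1))).sub
      (sobolevBound_weakD (0 : SobolevH (k + 1)))).mono (D := D) (by simp)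
    rwa [sub_self] at h
  have sol : ∀ (w : SobolevH (k + 1)) (u : SobolevH 1), ‖w‖₊ ≤ C → PorosityGe ε w →
      SolvesElliptic n m (porosity w) u → ∃ v V, L2Bound v V ∧
      IsWeakDeriv (weakD u 0) ((1 + fun z => (1 + weakD w 0 z) ^ (-n) - 1) * v
        - fun z => (1 + weakD w 0 z) ^ (-n) - 1) ∧
      IsWeakDeriv v ((1 + fun z => (1 + weakD w 0 z) ^ m - 1) * weakD u 0) ∧
      SobolevBound (k + 1) (weakD u 0) (K * N) ∧ SobolevBound (k + 1) v (K * N) := by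
    intro w u hw hwε hu
    obtain ⟨a1, a2, a3, a4⟩ := coef w hw hwε
    obtain ⟨v, V, hv, hs1, hs2⟩ := hu.system hε hwε
    have hf := a1.const_mul (-1)
    simp only [nnnorm_neg, nnnorm_one, one_mul] at hf
    have := hK _ _ _ _ _ 0 N _ _ a1 a2 a3 a4 (l2Bound_weakD u 0) hv hf (zero N)
      (hs1.congr_ae (ae_eq_refl _) (Eventually.of_forall fun z => by
        simp [sub_eq_add_neg])) (by simpa using hs2)
    exact ⟨v, V, hv, hs1, hs2, this⟩
  -- `E` times `‖w - w'‖` bounds both forcing terms of the system for the difference of two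
  -- solutions.
  set E : ℝ≥0 := max (2 ^ (k + 2) * (L₁ * (K * N)) + L₁) (2 ^ (k + 2) * (L₂ * (K * N))) with hE
  refine ⟨K * N + 2 ^ (k + 2) * (N * (K * N)), K * E + (2 ^ (k + 2) * (N * (K * E)) + E),
    fun w u hw hwε hu => ?_, fun w w' u u' hw hwε hw' hwε' hu hu' => ?_⟩
  · obtain ⟨a1, a2, a3, a4⟩ := coef w hw hwε
    obtain ⟨v, V, hv, hs1, hs2, s1, s2⟩ := sol w u hw hwε hu
    refine (s1.add (a2.mul s1)).congr_ae (Eventually.of_forall fun z => ?_)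
    simp only [porosity, Pi.add_apply, Pi.mul_apply]
    ring
  · obtain ⟨a1, a2, a3, a4⟩ := coef w hw hwε
    obtain ⟨v, V, hv, hs1, hs2, s1, s2⟩ := sol w u hw hwε hu
    obtain ⟨v', V', hv', hs1', hs2', s1', s2'⟩ := sol w' u' hw' hwε' hu'
    obtain ⟨a1', a2', -, -⟩ := coef w' hw' hwε'
    set D := ‖w - w'‖₊ with hD
    have hb := (sobolevBound_weakD w).mono hw
    have hb' := (sobolevBound_weakD w').mono hw'
    have hd := (sobolevBound_weakD (w - w')).congr_ae (weakD_sub w w' 0)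
    have d1 := hL₁ _ _ D hb hwε.ae_le hb' hwε'.ae_le hd
    have d2 := hL₂ _ _ D hb hwε.ae_le hb' hwε'.ae_le hd
    -- With `d₁, d₂` the differences of `φ^(-n)` and of `φ^m`, the forcing terms are `d₁ v' - d₁`
    -- and `d₂ u'`, primes marking the second solution.
    have f1 := ((d1.mul s2').sub d1).mono (D := E * D) (by
      calc _ = (2 ^ (k + 2) * (L₁ * (K * N)) + L₁) * D := by ring
        _ ≤ E * D := by gcongr; exact le_max_left _ _)
    have f2 := (d2.mul s1').mono (D := E * D) (by
      calc _ = (2 ^ (k + 2) * (L₂ * (K * N))) * D := by ring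
        _ ≤ E * D := by gcongr; exact le_max_right _ _)
    have lf : ∀ {A q : ℝ → ℝ}, SobolevBound (k + 1) A N → SobolevBound (k + 1) q (K * N) →
        LocallyIntegrable ((1 + A) * q) := by
      intro A q hA hq
      have := (hq.add (hA.mul hq)).locallyIntegrable
      rwa [show (1 + A) * q = q + A * q by ring]
    obtain ⟨r1, r2⟩ := hK _ _ (weakD u 0 - weakD u' 0) (v - v') _ _ (E * D) _ _ a1 a2 a3 a4
      (s1.sub s1').l2 (s2.sub s2').l2 f1 f2
      ((hs1.sub hs1' s1.locallyIntegrable ((lf a1 s2).sub a1.locallyIntegrable)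
        s1'.locallyIntegrable ((lf a1' s2').sub a1'.locallyIntegrable)).congr_ae (ae_eq_refl _)
        (Eventually.of_forall fun z => by
          simp only [Pi.add_apply, Pi.mul_apply, Pi.sub_apply, Pi.one_apply]; ring))
      ((hs2.sub hs2' s2.locallyIntegrable (lf a2 s1) s2'.locallyIntegrable
        (lf a2' s1')).congr_ae (ae_eq_refl _)
        (Eventually.of_forall fun z => by
          simp only [Pi.add_apply, Pi.mul_apply, Pi.sub_apply, Pi.one_apply]; ring))
    -- With `ψ` the second porosity, `φ^m u - ψ^m u' = (u - u') + (φ^m - 1)(u - u') + (φ^m - ψ^m)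
    -- u'`.
    refine ⟨r1.mono ?_, ((r1.add ((a2.mul r1).add f2)).mono (le_of_eq (by ring))).congr_ae
      (Eventually.of_forall fun z => ?_)⟩
    · calc K * (E * D) = K * E * D + 0 := by ring
        _ ≤ K * E * D + (2 ^ (k + 2) * (N * (K * E)) + E) * D := by gcongr; exact zero_le
        _ = _ := by ring
    · simp only [porosity, Pi.add_apply, Pi.mul_apply, Pi.sub_apply]
      ring

/-- The Lipschitz estimate with both porosities equal has right side zero. -/
theorem SolvesElliptic.unique {w : SobolevH (k + 1)} (hε : 0 < ε) (hw : PorosityGe ε w)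
    {u u' : SobolevH 1} (h : SolvesElliptic n m (porosity w) u)
    (h' : SolvesElliptic n m (porosity w) u') : u' = u := by
  obtain ⟨_, L, _, hL⟩ := elliptic_bounds k n m hε ‖w‖₊
  have h1 := (hL w w u' u le_rfl hw le_rfl hw h' h).1.l2.2
  simp only [sub_self, nnnorm_zero, mul_zero, ENNReal.coe_zero, nonpos_iff_eq_zero] at h1
  rw [eLpNorm_eq_zero_iff ((l2Bound_weakD u' 0).1.sub (l2Bound_weakD u 0).1) (by norm_num)] at h1
  refine SobolevH.ext_ae ?_
  filter_upwards [h1] with z hz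
  simpa [sub_eq_zero] using hz

/-- Shows that for `φ ≥ ε > 0` the choice in `rate` never falls back on its default value `0`, and
that the `u` behind it is the only solution. -/
theorem exists_rate {w : SobolevH (k + 1)} (hε : 0 < ε) (hw : PorosityGe ε w) (n m : ℝ) :
    ∃ u : SobolevH 1, SolvesElliptic n m (porosity w) u ∧
      IsPowTimes m (porosity w) u (rate n m w) ∧
      ∀ u' : SobolevH 1, SolvesElliptic n m (porosity w) u' → u' = u := by
  obtain ⟨u₀, hu₀⟩ := exists_solvesElliptic (n := n) (m := m) hε hw
  obtain ⟨K, _, hK, _⟩ := elliptic_bounds k n m hε ‖w‖₊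
  obtain ⟨r, hr, -⟩ := (hK w u₀ le_rfl hw hu₀).exists_sobolevH
  have hex : ∃ r : SobolevH (k + 1), ∃ u : SobolevH 1,
      SolvesElliptic n m (porosity w) u ∧ IsPowTimes m (porosity w) u r := ⟨r, u₀, hu₀, hr⟩
  obtain ⟨u, hu, hur⟩ := hex.choose_spec
  refine ⟨u, hu, ?_, fun u' hu' => hu.unique hε hw hu'⟩
  rw [rate, dif_pos hex]
  exact hur

theorem IsPowTimes.eq_rate {w r : SobolevH (k + 1)} (hε : 0 < ε) (hw : PorosityGe ε w)
    {u : SobolevH 1} (hu : SolvesElliptic n m (porosity w) u)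
    (hr : IsPowTimes m (porosity w) u r) : r = rate n m w := by
  obtain ⟨u', _, h2, h3⟩ := exists_rate hε hw n m
  rw [h3 u hu] at hr
  exact SobolevH.ext_ae (hr.trans h2.symm)

/-- The set of all `φ = 1 + w` with `‖w‖ ≤ R` and `φ ≥ ε`. -/
def porositySet (k : ℕ) (R ε : ℝ) : Set (SobolevH k) := {w | ‖w‖ ≤ R ∧ PorosityGe ε w}

/-- The sole analytic input to the time-dependent theory: it makes the evolution an ODE with a
vector field that is Lipschitz on each `porositySet`. -/
theorem rate_bounds (k : ℕ) (n m R : ℝ) (hε : 0 < ε) : ∃ M L : ℝ≥0,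
    (∀ w ∈ porositySet (k + 1) R ε, ‖rate n m w‖ ≤ M) ∧
    LipschitzOnWith L (rate n m) (porositySet (k + 1) R ε) := by
  obtain ⟨K, L, hK, hL⟩ := elliptic_bounds k n m hε R.toNNReal
  have hR : ∀ w ∈ porositySet (k + 1) R ε, ‖w‖₊ ≤ R.toNNReal := fun w hw =>
    NNReal.le_toNNReal_of_coe_le hw.1
  refine ⟨(k + 2) * K, (k + 2) * L, fun w hw => ?_, LipschitzOnWith.of_dist_le_mul
    fun w hw w' hw' => ?_⟩
  · obtain ⟨u, hu, hr, -⟩ := exists_rate hε hw.2 n m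
    refine (norm_le_of_sobolevBound ((hK w u (hR w hw) hw.2 hu).congr_ae hr.symm)).trans
      (le_of_eq ?_)
    push_cast
    ring
  · obtain ⟨u, hu, hr, -⟩ := exists_rate hε hw.2 n m
    obtain ⟨u', hu', hr', -⟩ := exists_rate hε hw'.2 n m
    have h := (hL w w' u u' (hR w hw) hw.2 (hR w' hw') hw'.2 hu hu').2
    rw [dist_eq_norm, dist_eq_norm]
    refine (norm_le_of_sobolevBound (h.congr_ae ?_)).trans (le_of_eq ?_)
    · exact (hr.sub hr').symm.trans (weakD_sub _ _ 0).symm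
    · push_cast
      ring

end Elliptic

/-! ### Positivity of the porosity and its stability -/

section Porosity

variable {k : ℕ} {n m ε : ℝ}

theorem PorosityGe.mono {w : SobolevH k} (h : PorosityGe ε w) {c : ℝ} (hc : c ≤ ε) :
    PorosityGe c w := Eventually.mono h fun _ hz => hc.trans hz

/-- The factor `2` is the constant of the embedding into bounded functions. -/
theorem PorosityGe.of_norm_sub_le {w v : SobolevH (k + 1)} (h : PorosityGe ε w) {d : ℝ}
    (hd : ‖v - w‖ ≤ d) : PorosityGe (ε - 2 * d) v := by
  filter_upwards [h.ae_le, (sobolevBound_weakD (v - w)).abs_le, weakD_sub v w 0] with z h1 h2 h3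
  rw [h3, coe_nnnorm] at h2
  have := neg_le_of_abs_le h2
  simp only [Pi.sub_apply] at this
  simp only [porosity]
  linarith

theorem porositySet_mono {R R' c : ℝ} (hR : R ≤ R') (hc : c ≤ ε) :
    porositySet k R ε ⊆ porositySet k R' c := fun _ h => ⟨h.1.trans hR, h.2.mono hc⟩

theorem mem_porositySet_of_norm_sub_le {w₀ w : SobolevH (k + 1)} {R d : ℝ}
    (h : w₀ ∈ porositySet (k + 1) R ε) (hd : ‖w - w₀‖ ≤ d) :
    w ∈ porositySet (k + 1) (R + d) (ε - 2 * d) := by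
  refine ⟨?_, h.2.of_norm_sub_le hd⟩
  have := norm_add_le w₀ (w - w₀)
  rw [add_sub_cancel] at this
  linarith [h.1]

theorem PorosityGe.pos {w : SobolevH (k + 1)} (hε : 0 < ε) (h : PorosityGe ε w) :
    PorosityPos w := by
  obtain ⟨F, hc, hF, -⟩ := ((sobolevBound_weakD w).of_le
    (show 1 ≤ k + 1 by omega)).exists_continuous
  have hg : Continuous fun z => 1 + F z := continuous_const.add hc
  refine ⟨fun z => 1 + F z, hg, ?_, fun z => hε.trans_le (hg.le_of_ae_le ?_ z)⟩
  · filter_upwards [hF] with z hz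
    rw [porosity, hz]
  · filter_upwards [hF, h.ae_le] with z hz h1
    rwa [← hz]

/-- As `φ → 1` at both ends, `φ > 1/2` outside a compact interval, and on that interval the
continuous representative attains a positive minimum. Pointwise positivity is thus uniform. -/
theorem PorosityPos.exists_ge {w : SobolevH (k + 1)} (h : PorosityPos w) :
    ∃ ε > 0, PorosityGe ε w := by
  obtain ⟨F, hc, hF, -, top, bot⟩ := ((sobolevBound_weakD w).of_le
    (show 1 ≤ k + 1 by omega)).exists_continuous
  obtain ⟨g, hg, hgw, hpos⟩ := h
  have e : g = fun z => 1 + F z := by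
    refine (hg.ae_eq_iff_eq volume (continuous_const.add hc)).1 ?_
    filter_upwards [hF, hgw] with z h1 h2
    rw [h2, porosity, h1]
    rfl
  have ht : ∀ᶠ z in atTop, 1 / 2 < g z := by
    have := top.const_add 1
    rw [e]
    exact this.eventually (lt_mem_nhds (by norm_num))
  have hb : ∀ᶠ z in atBot, 1 / 2 < g z := by
    have := bot.const_add 1
    rw [e]
    exact this.eventually (lt_mem_nhds (by norm_num))
  obtain ⟨a, ha⟩ := eventually_atTop.1 ht
  obtain ⟨b, hb⟩ := eventually_atBot.1 hb
  obtain ⟨x, -, hx⟩ := (isCompact_uIcc (a := b) (b := a)).exists_isMinOn nonempty_uIcc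
    hg.continuousOn
  refine ⟨min (1 / 2) (g x), lt_min (by norm_num) (hpos x), ?_⟩
  filter_upwards [hgw] with z hz
  rw [← hz]
  by_cases h1 : a ≤ z
  · exact (min_le_left _ _).trans (ha z h1).le
  · by_cases h2 : z ≤ b
    · exact (min_le_left _ _).trans (hb z h2).le
    · push Not at h1 h2
      exact (min_le_right _ _).trans (hx (by
        rw [uIcc_of_le (h2.trans h1).le]; exact ⟨h2.le, h1.le⟩))

theorem PorosityPos.exists_porositySet_mem_nhds {w : SobolevH (k + 1)} (h : PorosityPos w) :
    ∃ R ε, 0 < ε ∧ porositySet (k + 1) R ε ∈ 𝓝 w := by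
  obtain ⟨ε, hε, hw⟩ := h.exists_ge
  refine ⟨‖w‖ + ε / 4, ε / 2, by positivity, ?_⟩
  filter_upwards [Metric.closedBall_mem_nhds w (show 0 < ε / 4 by positivity)] with v hv
  rw [mem_closedBall_iff_norm] at hv
  have := mem_porositySet_of_norm_sub_le (R := ‖w‖) ⟨le_rfl, hw⟩ hv
  rwa [show ε - 2 * (ε / 4) = ε / 2 by ring] at this

theorem PorosityPos.continuousAt_rate {w : SobolevH (k + 1)} (h : PorosityPos w) (n m : ℝ) :
    ContinuousAt (rate n m : SobolevH (k + 1) → SobolevH (k + 1)) w := by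
  obtain ⟨R, ε, hε, hn⟩ := h.exists_porositySet_mem_nhds
  obtain ⟨_, L, _, hL⟩ := rate_bounds k n m R hε
  exact hL.continuousOn.continuousAt hn

/-- Such sets are neighbourhoods locally, and any two lie in a third; compactness then yields a
single one. It provides one Lipschitz constant along whole trajectories. -/
theorem exists_porositySet_of_isCompact {K : Set (SobolevH (k + 1))} (hK : IsCompact K)
    (hpos : ∀ w ∈ K, PorosityPos w) : ∃ R ε, 0 < ε ∧ K ⊆ porositySet (k + 1) R ε := by
  refine hK.induction_on (p := fun s => ∃ R ε, 0 < ε ∧ s ⊆ porositySet (k + 1) R ε)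
    ⟨0, 1, one_pos, empty_subset _⟩ ?_ ?_ ?_
  · rintro s t hst ⟨R, ε, hε, h⟩
    exact ⟨R, ε, hε, hst.trans h⟩
  · rintro s t ⟨R, ε, hε, h⟩ ⟨R', ε', hε', h'⟩
    exact ⟨max R R', min ε ε', lt_min hε hε', union_subset
      (h.trans (porositySet_mono (le_max_left _ _) (min_le_left _ _)))
      (h'.trans (porositySet_mono (le_max_right _ _) (min_le_right _ _)))⟩
  · intro w hw
    obtain ⟨R, ε, hε, hn⟩ := (hpos w hw).exists_porositySet_mem_nhds
    exact ⟨_, mem_nhdsWithin_of_mem_nhds hn, R, ε, hε, Subset.rfl⟩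

end Porosity

/-! ### Half-open time intervals -/

section TimeInterval

theorem timeInterval_coe (T : ℝ) : timeInterval (T : EReal) = Ico 0 T := by
  ext t
  simp [timeInterval]

theorem timeInterval_mono {S T : EReal} (h : S ≤ T) : timeInterval S ⊆ timeInterval T :=
  fun _ ht => ⟨ht.1, ht.2.trans_le h⟩

theorem Icc_subset_timeInterval {T : EReal} {t : ℝ} (ht : t ∈ timeInterval T) :
    Icc 0 t ⊆ timeInterval T :=
  fun _ hs => ⟨hs.1, (EReal.coe_le_coe_iff.2 hs.2).trans_lt ht.2⟩

theorem isOpen_coe_lt (T : EReal) : IsOpen {t : ℝ | (t : EReal) < T} :=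
  isOpen_lt continuous_coe_real_ereal continuous_const

theorem uniqueDiffOn_timeInterval (T : EReal) : UniqueDiffOn ℝ (timeInterval T) :=
  (uniqueDiffOn_Ici 0).inter (isOpen_coe_lt T)

theorem timeInterval_mem_nhdsWithin {S T : EReal} {t : ℝ} (ht : t ∈ timeInterval S) :
    timeInterval S ∈ 𝓝[timeInterval T] t := by
  filter_upwards [self_mem_nhdsWithin, mem_nhdsWithin_of_mem_nhds
    ((isOpen_coe_lt S).mem_nhds ht.2)] with s h1 h2
  exact ⟨h1.1, h2⟩

theorem timeInterval_mem_nhdsWithin_Ici {T : EReal} {t : ℝ} (ht : t ∈ timeInterval T) :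
    timeInterval T ∈ 𝓝[Ici t] t := by
  filter_upwards [self_mem_nhdsWithin, mem_nhdsWithin_of_mem_nhds
    ((isOpen_coe_lt T).mem_nhds ht.2)] with s h1 h2
  exact ⟨ht.1.trans h1, h2⟩

end TimeInterval

theorem contDiffOn_one_of_hasDerivWithinAt {E : Type*} [NormedAddCommGroup E] [NormedSpace ℝ E]
    {f f' : ℝ → E} {s : Set ℝ} (hs : UniqueDiffOn ℝ s)
    (h : ∀ t ∈ s, HasDerivWithinAt f (f' t) s t) (hc : ContinuousOn f' s) :
    ContDiffOn ℝ 1 f s := by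
  rw [contDiffOn_one_iff_derivWithin hs]
  exact ⟨fun t ht => (h t ht).differentiableWithinAt,
    hc.congr fun t ht => (h t ht).derivWithin (hs t ht)⟩

/-! ### Local solutions as solutions of an ODE: uniqueness and gluing -/

section LocalSolution

variable {k : ℕ} {n m : ℝ}

/-- Uniqueness for the elliptic problem forces `r = rate n m (w t)`. Conversely, local Lipschitz
continuity of `rate` makes `r` continuous, and the integral equation is the fundamental theorem of
calculus. For `T ≤ 0` the interval is empty, so the initial condition is required only for `T > 0`.
-/
theorem isLocalSolution_iff {w₀ : SobolevH (k + 1)} {T : EReal} {w : ℝ → SobolevH (k + 1)} :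
    IsLocalSolution n m w₀ T w ↔ (0 < T → w 0 = w₀) ∧ ∀ t ∈ timeInterval T,
      PorosityPos (w t) ∧ HasDerivWithinAt w (rate n m (w t)) (timeInterval T) t := by
  constructor
  · rintro ⟨-, hpos, u, r, -, h⟩
    refine ⟨fun hT => ?_, fun t ht => ⟨hpos t ht, ?_⟩⟩
    · have := (h 0 ⟨le_rfl, by simpa using hT⟩).2.2.2
      simpa using this
    · obtain ⟨h1, h2, h3, -⟩ := h t ht
      obtain ⟨ε, hε, hge⟩ := (hpos t ht).exists_ge
      rwa [h2.eq_rate hε hge h1] at h3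
  · rintro ⟨h0, h⟩
    have hw : ContinuousOn w (timeInterval T) := fun t ht => (h t ht).2.continuousWithinAt
    have hr : ContinuousOn (fun t => rate n m (w t)) (timeInterval T) := fun t ht =>
      ((h t ht).1.continuousAt_rate n m).comp_continuousWithinAt (hw t ht)
    have hu : ∀ t, ∃ u : SobolevH 1, t ∈ timeInterval T →
        SolvesElliptic n m (porosity (w t)) u ∧
        IsPowTimes m (porosity (w t)) u (rate n m (w t)) := by
      intro t
      by_cases ht : t ∈ timeInterval T
      · obtain ⟨ε, hε, hge⟩ := (h t ht).1.exists_ge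
        obtain ⟨u, h1, h2, -⟩ := exists_rate hε hge n m
        exact ⟨u, fun _ => ⟨h1, h2⟩⟩
      · exact ⟨0, fun h => absurd h ht⟩
    choose u hu using hu
    refine ⟨contDiffOn_one_of_hasDerivWithinAt (uniqueDiffOn_timeInterval T)
      (fun t ht => (h t ht).2) hr, fun t ht => (h t ht).1, u, fun t => rate n m (w t), hr,
      fun t ht => ⟨(hu t ht).1, (hu t ht).2, (h t ht).2, ?_⟩⟩
    have hT : 0 < T := lt_of_le_of_lt (by exact_mod_cast ht.1) ht.2
    have hsub := Icc_subset_timeInterval ht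
    rw [intervalIntegral.integral_eq_sub_of_hasDeriv_right_of_le ht.1 (hw.mono hsub)
      (fun s hs => ?_) ((hr.mono hsub).intervalIntegrable_of_Icc ht.1), h0 hT]
    · abel
    · have hs' := hsub (Ioo_subset_Icc_self hs)
      exact ((h s hs').2.mono_of_mem_nhdsWithin (timeInterval_mem_nhdsWithin_Ici hs')).mono
        Ioi_subset_Ici_self

/-- Two solutions of the differential equation which agree at time `0` agree. -/
theorem eq_of_solutions {S T : EReal} {w v : ℝ → SobolevH (k + 1)}
    (hw : ∀ t ∈ timeInterval S, PorosityPos (w t) ∧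
      HasDerivWithinAt w (rate n m (w t)) (timeInterval S) t)
    (hv : ∀ t ∈ timeInterval T, PorosityPos (v t) ∧
      HasDerivWithinAt v (rate n m (v t)) (timeInterval T) t)
    (h0 : w 0 = v 0) {t : ℝ} (hS : t ∈ timeInterval S) (hT : t ∈ timeInterval T) :
    w t = v t := by
  have hSs := Icc_subset_timeInterval hS
  have hTs := Icc_subset_timeInterval hT
  have cw : ContinuousOn w (Icc 0 t) := fun s hs =>
    (hw s (hSs hs)).2.continuousWithinAt.mono hSs
  have cv : ContinuousOn v (Icc 0 t) := fun s hs =>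
    (hv s (hTs hs)).2.continuousWithinAt.mono hTs
  -- Both arcs over `[0, t]` are compact, so one Lipschitz constant serves both and ODE uniqueness
  -- applies.
  obtain ⟨R, ε, hε, hK⟩ := exists_porositySet_of_isCompact
    ((isCompact_Icc.image_of_continuousOn cw).union (isCompact_Icc.image_of_continuousOn cv)) (by
      rintro _ (⟨s, hs, rfl⟩ | ⟨s, hs, rfl⟩)
      · exact (hw s (hSs hs)).1
      · exact (hv s (hTs hs)).1)
  obtain ⟨_, L, _, hL⟩ := rate_bounds k n m R hε
  exact ODE_solution_unique_of_mem_Icc_right (v := fun _ => rate n m)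
    (s := fun _ => porositySet (k + 1) R ε) (fun _ _ => hL) cw
    (fun s hs => (hw s (hSs (Ico_subset_Icc_self hs))).2.mono_of_mem_nhdsWithin
      (timeInterval_mem_nhdsWithin_Ici (hSs (Ico_subset_Icc_self hs))))
    (fun s hs => hK (Or.inl (mem_image_of_mem _ (Ico_subset_Icc_self hs)))) cv
    (fun s hs => (hv s (hTs (Ico_subset_Icc_self hs))).2.mono_of_mem_nhdsWithin
      (timeInterval_mem_nhdsWithin_Ici (hTs (Ico_subset_Icc_self hs))))
    (fun s hs => hK (Or.inr (mem_image_of_mem _ (Ico_subset_Icc_self hs)))) h0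
    (right_mem_Icc.2 hS.1)

theorem IsLocalSolution.eq {w₀ : SobolevH (k + 1)} {S T : EReal} {w v : ℝ → SobolevH (k + 1)}
    (hw : IsLocalSolution n m w₀ S w) (hv : IsLocalSolution n m w₀ T v) {t : ℝ}
    (hS : t ∈ timeInterval S) (hT : t ∈ timeInterval T) : w t = v t := by
  rw [isLocalSolution_iff] at hw hv
  have h : ∀ {T : EReal}, t ∈ timeInterval T → 0 < T := fun ht =>
    lt_of_le_of_lt (by exact_mod_cast ht.1) ht.2
  exact eq_of_solutions hw.2 hv.2 ((hw.1 (h hS)).trans (hv.1 (h hT)).symm) hS hT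

/-- A solution can be continued from time `t` by a solution with data `w t`. -/
theorem IsLocalSolution.glue {w₀ : SobolevH (k + 1)} {T : EReal} {w z : ℝ → SobolevH (k + 1)}
    (hw : IsLocalSolution n m w₀ T w) {t S : ℝ} (ht : t ∈ timeInterval T) (hS : 0 < S)
    (hz : IsLocalSolution n m (w t) (S : EReal) z) :
    IsLocalSolution n m w₀ ((t + S : ℝ) : EReal) fun s => if s ≤ t then w s else z (s - t) := by
  rw [isLocalSolution_iff] at hw hz ⊢
  rw [timeInterval_coe] at hz ⊢
  set v : ℝ → SobolevH (k + 1) := fun s => if s ≤ t then w s else z (s - t) with hv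
  have hT : 0 < T := lt_of_le_of_lt (by exact_mod_cast ht.1) ht.2
  have v1 : ∀ s, s ≤ t → v s = w s := fun s hs => if_pos hs
  have v2 : ∀ s, t ≤ s → v s = z (s - t) := by
    intro s hs
    rcases hs.eq_or_lt with rfl | hs
    · rw [v1 _ le_rfl, sub_self, hz.1 (by exact_mod_cast hS)]
    · exact if_neg hs.not_ge
  have hsub := Icc_subset_timeInterval ht
  -- Derivatives within `[0, t]` and within `[t, t + S)` are found separately and united. Outside
  -- the closure of a piece the claim is vacuous; at `s = t` both pieces give the same value.
  have d1 : ∀ s ∈ Ico 0 (t + S), HasDerivWithinAt v (rate n m (v s)) (Icc 0 t) s := by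
    intro s hs
    by_cases hst : s ≤ t
    · rw [v1 s hst]
      exact ((hw.2 s (hsub ⟨hs.1, hst⟩)).2.mono hsub).congr (fun x hx => v1 x hx.2) (v1 s hst)
    · refine HasFDerivWithinAt.of_notMem_closure ?_
      rw [isClosed_Icc.closure_eq]
      exact fun h => hst h.2
  have d2 : ∀ s ∈ Ico 0 (t + S), HasDerivWithinAt v (rate n m (v s)) (Ico t (t + S)) s := by
    intro s hs
    by_cases hst : t ≤ s
    · have hs' : s - t ∈ Ico 0 S := ⟨by linarith, by linarith [hs.2]⟩
      rw [v2 s hst]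
      have := HasDerivWithinAt.scomp (t' := Ico 0 S) (s := Ico t (t + S)) s (hz.2 _ hs').2
        ((hasDerivWithinAt_id s _).sub_const t)
        (fun x hx => ⟨by simpa using hx.1, by simp only [id]; linarith [hx.2]⟩)
      rw [one_smul] at this
      exact this.congr (fun x hx => v2 x hx.1) (v2 s hst)
    · refine HasFDerivWithinAt.of_notMem_closure ?_
      rw [closure_Ico (by linarith)]
      exact fun h => hst h.1
  refine ⟨fun _ => (v1 0 ht.1).trans (hw.1 hT), fun s hs => ⟨?_, ?_⟩⟩
  · change PorosityPos (v s)
    by_cases hst : s ≤ t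
    · rw [v1 s hst]
      exact (hw.2 s (hsub ⟨hs.1, hst⟩)).1
    · rw [v2 s (le_of_not_ge hst)]
      exact (hz.2 _ ⟨by linarith, by linarith [hs.2]⟩).1
  · rw [← Icc_union_Ico_eq_Ico ht.1 (by linarith)]
    exact (d1 s hs).union (d2 s hs)

end LocalSolution

/-! ### The map `Λ` on `𝒳` and its fixed point -/

section Contraction

variable {k : ℕ} {n m R ε T : ℝ} {M L : ℝ≥0}

theorem SpaceX.continuousOn_rate (hL : LipschitzOnWith L (rate n m) (porositySet k R ε))
    {w : ℝ → SobolevH k} (hw : w ∈ SpaceX k R ε T) :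
    ContinuousOn (fun t => rate n m (w t)) (Icc 0 T) :=
  hL.continuousOn.comp hw.1.continuousOn fun _ ht => hw.2 _ ht

theorem norm_Lam_sub_le (hM : ∀ w ∈ porositySet k R ε, ‖rate n m w‖ ≤ M) (w₀ : SobolevH k)
    {w : ℝ → SobolevH k} (hw : w ∈ SpaceX k R ε T) {t : ℝ} (ht : t ∈ Icc 0 T) :
    ‖Lam n m w₀ w t - w₀‖ ≤ M * T := by
  rw [Lam, add_sub_cancel_left]
  refine (intervalIntegral.norm_integral_le_of_norm_le_const (C := M) fun s hs => ?_).trans ?_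
  · rw [uIoc_of_le ht.1] at hs
    exact hM _ (hw.2 s ⟨hs.1.le, hs.2.trans ht.2⟩)
  · rw [sub_zero, abs_of_nonneg ht.1]
    gcongr
    exact ht.2

theorem Lam_mem_SpaceX {w₀ : SobolevH k} (hT : 0 < T)
    (hL : LipschitzOnWith L (rate n m) (porositySet k R ε))
    {w : ℝ → SobolevH k} (hw : w ∈ SpaceX k R ε T)
    (hball : ∀ t ∈ Icc 0 T, Lam n m w₀ w t ∈ porositySet k R ε) :
    Lam n m w₀ w ∈ SpaceX k R ε T := by
  refine ⟨contDiffOn_one_of_hasDerivWithinAt (uniqueDiffOn_Icc hT) (fun t ht => ?_)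
    (SpaceX.continuousOn_rate hL hw), hball⟩
  exact ODE.hasDerivWithinAt_picard_Icc (f := fun _ => rate n m) (u := porositySet k R ε)
    (left_mem_Icc.2 hT.le) (hL.continuousOn.comp continuousOn_snd fun x hx => hx.2)
    hw.1.continuousOn (fun t ht => hw.2 t ht) w₀ ht

theorem SpaceX.norm_sub_le_supDist {w v : ℝ → SobolevH k} (hw : w ∈ SpaceX k R ε T)
    (hv : v ∈ SpaceX k R ε T) {t : ℝ} (ht : t ∈ Icc 0 T) : ‖w t - v t‖ ≤ supDist T w v := by
  -- A real supremum over an unbounded family would be `0`, so the bound `R + R` has to be supplied.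
  refine le_ciSup (f := fun t : Icc (0 : ℝ) T => ‖w t - v t‖) ⟨R + R, ?_⟩ ⟨t, ht⟩
  rintro _ ⟨s, rfl⟩
  exact (norm_sub_le _ _).trans (add_le_add (hw.2 s s.2).1 (hv.2 s s.2).1)

theorem supDist_Lam_le (hT : 0 < T) (hL : LipschitzOnWith L (rate n m) (porositySet k R ε))
    (w₀ : SobolevH k) {w v : ℝ → SobolevH k} (hw : w ∈ SpaceX k R ε T)
    (hv : v ∈ SpaceX k R ε T) :
    supDist T (Lam n m w₀ w) (Lam n m w₀ v) ≤ L * T * supDist T w v := by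
  have : Nonempty (Icc (0 : ℝ) T) := ⟨⟨0, left_mem_Icc.2 hT.le⟩⟩
  have hs0 : 0 ≤ supDist T w v := Real.iSup_nonneg fun _ => norm_nonneg _
  refine ciSup_le fun t => ?_
  have hsub : Icc 0 (t : ℝ) ⊆ Icc 0 T := Icc_subset_Icc_right t.2.2
  simp only [Lam]
  rw [add_sub_add_left_eq_sub, ← intervalIntegral.integral_sub
    (((SpaceX.continuousOn_rate hL hw).mono hsub).intervalIntegrable_of_Icc t.2.1)
    (((SpaceX.continuousOn_rate hL hv).mono hsub).intervalIntegrable_of_Icc t.2.1)]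
  refine (intervalIntegral.norm_integral_le_of_norm_le_const (C := L * supDist T w v)
    fun s hs => ?_).trans ?_
  · rw [uIoc_of_le t.2.1] at hs
    have hs' : s ∈ Icc 0 T := ⟨hs.1.le, hs.2.trans t.2.2⟩
    rw [← dist_eq_norm]
    refine (hL.dist_le_mul _ (hw.2 s hs') _ (hv.2 s hs')).trans ?_
    rw [dist_eq_norm]
    gcongr
    exact SpaceX.norm_sub_le_supDist hw hv hs'
  · rw [sub_zero, abs_of_nonneg t.2.1]
    calc L * supDist T w v * t ≤ L * supDist T w v * T := by gcongr; exact t.2.2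
      _ = _ := by ring

/-- `C¹` curves are not complete in the sup metric, so the fixed point is found among Lipschitz
curves in a closed ball around `w₀`; its `C¹` regularity then comes from the equation. -/
theorem exists_fixedPoint {w₀ : SobolevH k} (hT : 0 < T)
    (hL : LipschitzOnWith L (rate n m) (porositySet k R ε))
    (hM : ∀ w ∈ porositySet k R ε, ‖rate n m w‖ ≤ M) {ρ : ℝ≥0}
    (hball : Metric.closedBall w₀ ρ ⊆ porositySet k R ε) (hρ : M * T ≤ ρ) :
    ∃ w ∈ SpaceX k R ε T, EqOn (Lam n m w₀ w) w (Icc 0 T) ∧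
      ∀ t ∈ Icc 0 T, HasDerivWithinAt w (rate n m (w t)) (Icc 0 T) t := by
  have h0 : (0 : ℝ) ∈ Icc 0 T := left_mem_Icc.2 hT.le
  have hPL : IsPicardLindelof (fun _ : ℝ => (rate n m : SobolevH k → SobolevH k))
      (⟨0, h0⟩ : Icc (0 : ℝ) T) w₀ ρ 0 M L :=
    ⟨fun _ _ => hL.mono hball, fun _ _ => continuousOn_const, fun _ _ x hx => hM x (hball hx), by
      simpa [max_eq_left hT.le] using hρ⟩
  obtain ⟨α, hα⟩ := ODE.FunSpace.exists_isFixedPt_next hPL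
    (Metric.mem_closedBall_self (x := w₀) le_rfl)
  have hmem : ∀ t, α.compProj t ∈ porositySet k R ε := fun t =>
    hball (α.compProj_mem_closedBall hPL.mul_max_le)
  have hfix : EqOn (Lam n m w₀ α.compProj) α.compProj (Icc 0 T) := by
    intro t ht
    rw [ODE.FunSpace.compProj_of_mem ht]
    nth_rewrite 2 [← hα]
    rw [ODE.FunSpace.next_apply]
    rfl
  have hder : ∀ t ∈ Icc 0 T,
      HasDerivWithinAt α.compProj (rate n m (α.compProj t)) (Icc 0 T) t := by
    intro t ht
    refine (ODE.hasDerivWithinAt_picard_Icc (f := fun _ => rate n m) (u := porositySet k R ε)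
      h0 (hL.continuousOn.comp continuousOn_snd fun x hx => hx.2)
      α.continuous_compProj.continuousOn (fun t _ => hmem t) w₀ ht).congr_of_mem
      (fun s hs => (hfix hs).symm) ht
  refine ⟨α.compProj, ⟨contDiffOn_one_of_hasDerivWithinAt (uniqueDiffOn_Icc hT) hder ?_,
    fun t _ => hmem t⟩, hfix, hder⟩
  exact hL.continuousOn.comp α.continuous_compProj.continuousOn fun t _ => hmem t

end Contraction

/-! ### The three assertions -/

section Main

variable {k : ℕ} {n m R ε : ℝ}

theorem local_existence (k : ℕ) (n m R : ℝ) (hε : 0 < ε) {δ : ℝ} (hδ : 0 < δ) :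
    ∃ T₀ : ℝ, 0 < T₀ ∧ ∃ α : ℝ, 0 ≤ α ∧ α < 1 ∧
      ∀ w₀ : SobolevH (k + 1), ‖w₀‖ ≤ R - δ → PorosityGe (2 * ε) w₀ →
      ∀ T : ℝ, 0 < T → T ≤ T₀ →
        (∀ w ∈ SpaceX (k + 1) R ε T, ∀ t ∈ Icc (0 : ℝ) T,
          ∃ u : SobolevH 1, SolvesElliptic n m (porosity (w t)) u ∧
            IsPowTimes m (porosity (w t)) u (rate n m (w t)) ∧
            ∀ u' : SobolevH 1, SolvesElliptic n m (porosity (w t)) u' → u' = u) ∧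
        (∀ w ∈ SpaceX (k + 1) R ε T, Lam n m w₀ w ∈ SpaceX (k + 1) R ε T) ∧
        (∀ w ∈ SpaceX (k + 1) R ε T, ∀ v ∈ SpaceX (k + 1) R ε T,
          supDist T (Lam n m w₀ w) (Lam n m w₀ v) ≤ α * supDist T w v) ∧
        ∃ w ∈ SpaceX (k + 1) R ε T,
          EqOn (Lam n m w₀ w) w (Icc 0 T) ∧
          (∀ v ∈ SpaceX (k + 1) R ε T, EqOn (Lam n m w₀ v) v (Icc 0 T) → EqOn v w (Icc 0 T)) ∧
          IsLocalSolution n m w₀ (T : EReal) w ∧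
          ∀ v : ℝ → SobolevH (k + 1), IsLocalSolution n m w₀ (T : EReal) v →
            EqOn v w (timeInterval (T : EReal)) := by
  obtain ⟨M, L, hM, hL⟩ := rate_bounds k n m R hε
  -- A move by `ρ` keeps the norm below `(R - δ) + δ` and the porosity above `2ε - 2(ε/2) = ε`.
  set ρ : ℝ := min δ (ε / 2) with hρ
  have hρ0 : 0 < ρ := lt_min hδ (by positivity)
  -- The first bound on `T` keeps `Λ` in the ball of radius `ρ`; the second makes its contraction
  -- factor `L T` at most `1/2`. Adding `1` avoids division by zero.
  refine ⟨min (ρ / (M + 1)) (1 / (2 * (L + 1))), by positivity, 1 / 2, by norm_num, by norm_num,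
    fun w₀ hw₀ hw₀ε T hT hTT => ?_⟩
  have hMT : M * T ≤ ρ := by
    have h1 := hTT.trans (min_le_left _ _)
    rw [le_div_iff₀ (by positivity)] at h1
    nlinarith
  have hLT : L * T ≤ 1 / 2 := by
    have h1 := hTT.trans (min_le_right _ _)
    rw [le_div_iff₀ (by positivity)] at h1
    nlinarith
  have hball : Metric.closedBall w₀ ρ ⊆ porositySet (k + 1) R ε := by
    intro w hw
    rw [mem_closedBall_iff_norm] at hw
    have h1 : ρ ≤ δ := min_le_left _ _
    have h2 : ρ ≤ ε / 2 := min_le_right _ _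
    exact porositySet_mono (by linarith) (by linarith)
      (mem_porositySet_of_norm_sub_le ⟨hw₀, hw₀ε⟩ hw)
  have hcontr : ∀ w ∈ SpaceX (k + 1) R ε T, ∀ v ∈ SpaceX (k + 1) R ε T,
      supDist T (Lam n m w₀ w) (Lam n m w₀ v) ≤ 1 / 2 * supDist T w v := by
    intro w hw v hv
    have hs0 : 0 ≤ supDist T w v := Real.iSup_nonneg fun _ => norm_nonneg _
    exact (supDist_Lam_le hT hL w₀ hw hv).trans (by gcongr)
  obtain ⟨w, hw, hfix, hder⟩ := exists_fixedPoint hT hL hM (ρ := ρ.toNNReal)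
    (by rwa [Real.coe_toNNReal _ hρ0.le]) (by rwa [Real.coe_toNNReal _ hρ0.le])
  have hsol : IsLocalSolution n m w₀ (T : EReal) w := by
    rw [isLocalSolution_iff, timeInterval_coe]
    refine ⟨fun _ => ?_, fun t ht => ?_⟩
    · rw [← hfix (left_mem_Icc.2 hT.le)]
      simp [Lam]
    · have ht' := Ico_subset_Icc_self ht
      exact ⟨(hw.2 t ht').2.pos hε, (hder t ht').mono Ico_subset_Icc_self⟩
  refine ⟨fun w hw t ht => exists_rate hε (hw.2 t ht).2 n m,
    fun w hw => Lam_mem_SpaceX hT hL hw fun t ht => hball ?_, hcontr, w, hw, hfix,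
    fun v hv hvfix t ht => ?_, hsol, fun v hv t ht => hv.eq hsol ht ht⟩
  · rw [mem_closedBall_iff_norm]
    exact (norm_Lam_sub_le hM w₀ hw ht).trans hMT
  -- Two fixed points are at a distance at most half of itself, hence zero.
  · have e : supDist T (Lam n m w₀ v) (Lam n m w₀ w) = supDist T v w := by
      simp only [supDist]
      congr 1
      ext s
      rw [hvfix s.2, hfix s.2]
    have h1 := hcontr v hv w hw
    have h2 := SpaceX.norm_sub_le_supDist hv hw ht
    rw [e] at h1
    rw [← sub_eq_zero, ← norm_le_zero_iff]
    linarith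

/-- Grönwall's inequality, with `C` the Lipschitz constant of `rate` on the set containing both
trajectories. -/
theorem continuous_dependence (k : ℕ) (n m R : ℝ) (hε : 0 < ε) :
    ∃ C : ℝ, ∀ T : ℝ, 0 < T → ∀ (w₀ v₀ : SobolevH (k + 1)) (w v : ℝ → SobolevH (k + 1)),
      w ∈ SpaceX (k + 1) R ε T → v ∈ SpaceX (k + 1) R ε T →
      IsLocalSolution n m w₀ (T : EReal) w → IsLocalSolution n m v₀ (T : EReal) v →
      ∀ t ∈ timeInterval (T : EReal), ‖w t - v t‖ ≤ ‖w₀ - v₀‖ * Real.exp (C * t) := by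
  obtain ⟨_, L, _, hL⟩ := rate_bounds k n m R hε
  refine ⟨L, fun T hT w₀ v₀ w v hw hv hws hvs t ht => ?_⟩
  rw [isLocalSolution_iff] at hws hvs
  have hsub := Icc_subset_timeInterval ht
  have hIcc : Icc 0 t ⊆ Icc 0 T := hsub.trans (by
    rw [timeInterval_coe]; exact Ico_subset_Icc_self)
  have hT' : (0 : EReal) < T := by exact_mod_cast hT
  have key := dist_le_of_trajectories_ODE_of_mem (v := fun _ => rate n m)
    (s := fun _ => porositySet (k + 1) R ε) (δ := ‖w₀ - v₀‖) (a := 0) (b := t) (fun _ _ => hL)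
    (hw.1.continuousOn.mono hIcc)
    (fun s hs => (hws.2 s (hsub (Ico_subset_Icc_self hs))).2.mono_of_mem_nhdsWithin
      (timeInterval_mem_nhdsWithin_Ici (hsub (Ico_subset_Icc_self hs))))
    (fun s hs => hw.2 s (hIcc (Ico_subset_Icc_self hs)))
    (hv.1.continuousOn.mono hIcc)
    (fun s hs => (hvs.2 s (hsub (Ico_subset_Icc_self hs))).2.mono_of_mem_nhdsWithin
      (timeInterval_mem_nhdsWithin_Ici (hsub (Ico_subset_Icc_self hs))))
    (fun s hs => hv.2 s (hIcc (Ico_subset_Icc_self hs)))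
    (by rw [hws.1 hT', hvs.1 hT', dist_eq_norm]) t (right_mem_Icc.2 ht.1)
  rwa [sub_zero, dist_eq_norm] at key

/-- The union of all local solutions is consistent by uniqueness. As the intervals are half-open,
those of the local solutions cover `[0, sSup S)`, so the supremum is itself a time of existence. -/
theorem exists_maximal_solution {w₀ : SobolevH (k + 1)}
    (h : ∃ (T : ℝ) (v : ℝ → SobolevH (k + 1)), 0 < T ∧ IsLocalSolution n m w₀ (T : EReal) v) :
    ∃ (Tmax : EReal) (w : ℝ → SobolevH (k + 1)), 0 < Tmax ∧ IsLocalSolution n m w₀ Tmax w ∧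
      ∀ (T : EReal) (v : ℝ → SobolevH (k + 1)), IsLocalSolution n m w₀ T v →
        T ≤ Tmax ∧ EqOn v w (timeInterval T) := by
  classical
  set S : Set EReal := {T | ∃ v, IsLocalSolution n m w₀ T v} with hS
  have hex : ∀ t ∈ timeInterval (sSup S), ∃ T v, IsLocalSolution n m w₀ T v ∧
      t ∈ timeInterval T := by
    intro t ht
    obtain ⟨T, ⟨v, hv⟩, hT⟩ := lt_sSup_iff.1 ht.2
    exact ⟨T, v, hv, ht.1, hT⟩
  have hle : ∀ {T v}, IsLocalSolution n m w₀ T v → T ≤ sSup S := fun hv => le_sSup ⟨_, hv⟩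
  let w : ℝ → SobolevH (k + 1) := fun t =>
    if ht : t ∈ timeInterval (sSup S) then (hex t ht).choose_spec.choose t else 0
  have hw : ∀ {T v}, IsLocalSolution n m w₀ T v → EqOn v w (timeInterval T) := by
    intro T v hv t ht
    have ht' := timeInterval_mono (hle hv) ht
    have hc := (hex t ht').choose_spec.choose_spec
    simp only [w, dif_pos ht']
    exact hv.eq hc.1 ht hc.2
  obtain ⟨T₁, v₁, hT₁, hv₁⟩ := h
  have hT₁' : (0 : EReal) < T₁ := by exact_mod_cast hT₁
  refine ⟨sSup S, w, hT₁'.trans_le (hle hv₁), ?_, fun T v hv => ⟨hle hv, hw hv⟩⟩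
  rw [isLocalSolution_iff]
  refine ⟨fun _ => ?_, fun t ht => ?_⟩
  · rw [← hw hv₁ ⟨le_rfl, by simpa using hT₁'⟩]
    exact (isLocalSolution_iff.1 hv₁).1 hT₁'
  · obtain ⟨T, v, hv, hT⟩ := hex t ht
    have hs := (isLocalSolution_iff.1 hv).2 t hT
    rw [← hw hv hT]
    refine ⟨hs.1, ?_⟩
    have := hs.2.congr (fun x hx => (hw hv hx).symm) (hw hv hT).symm
    exact this.mono_of_mem_nhdsWithin (timeInterval_mem_nhdsWithin hT)

/-- Using `x + 1` instead of `x` keeps the lower bound positive when `x = 0`. -/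
theorem porosityGe_inv_of_eLpNorm_inv_le {w : SobolevH (k + 1)} (hw : PorosityPos w) {x : ℝ≥0}
    (h : eLpNorm (fun z => (porosity w z)⁻¹) ∞ volume ≤ x) : PorosityGe (x + 1 : ℝ)⁻¹ w := by
  obtain ⟨g, _, hg, hpos⟩ := hw
  filter_upwards [hg, ae_le_eLpNormEssSup (f := fun z => (porosity w z)⁻¹) (μ := volume)]
    with z h1 h2
  rw [eLpNorm_exponent_top] at h
  have h3 := h2.trans h
  have hz : 0 < porosity w z := h1 ▸ hpos z
  have h4 : ‖(porosity w z)⁻¹‖₊ ≤ x := by exact_mod_cast h3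
  have h5 : (porosity w z)⁻¹ ≤ x := (le_abs_self _).trans h4
  rw [inv_le_comm₀ (by positivity) hz]
  linarith

/-- If the limit fails, some `x` bounds the sum at times arbitrarily close to `T`. The existence
time `T₁` from such data depends only on `x` and the fixed parameters, so restarting after `T - T₁`
yields a solution living beyond `T`. -/
theorem IsLocalSolution.blow_up {w₀ : SobolevH (k + 1)} {T : ℝ} {w : ℝ → SobolevH (k + 1)}
    (hT : 0 < T) (hw : IsLocalSolution n m w₀ (T : EReal) w)
    (hmax : ∀ (S : EReal) (v : ℝ → SobolevH (k + 1)), IsLocalSolution n m w₀ S v →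
      S ≤ (T : EReal)) :
    Tendsto (fun t : ℝ => ‖w t‖ₑ + eLpNorm (fun z => (porosity (w t) z)⁻¹) ∞ volume)
      (𝓝[<] T) (𝓝 ∞) := by
  rw [ENNReal.tendsto_nhds_top_iff_nnreal]
  intro x
  by_contra hcon
  -- Norm at most `x = (x + 1) - 1` gives `δ = 1`, and `2ε = (x + 1)⁻¹` is the available lower
  -- bound.
  obtain ⟨T₁, hT₁, _, _, _, hloc⟩ := local_existence k n m (x + 1)
    (ε := (x + 1 : ℝ)⁻¹ / 2) (by positivity) one_pos
  have hev : ∀ᶠ t in 𝓝[<] T, t ∈ Ioo (max 0 (T - T₁)) T :=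
    Ioo_mem_nhdsLT (max_lt hT (by linarith))
  obtain ⟨t, ht, htI⟩ := ((not_eventually.1 hcon).and_eventually hev).exists
  rw [not_lt] at ht
  have ht0 : t ∈ timeInterval (T : EReal) := by
    rw [timeInterval_coe]
    exact ⟨(le_max_left _ _).trans htI.1.le, htI.2⟩
  have h1 : ‖w t‖ ≤ x := by
    have : ‖w t‖₊ ≤ x := by exact_mod_cast le_self_add.trans ht
    exact this
  have h2 := porosityGe_inv_of_eLpNorm_inv_le ((isLocalSolution_iff.1 hw).2 t ht0).1
    (le_add_self.trans ht)
  obtain ⟨-, -, -, z, -, -, -, hz, -⟩ := hloc (w t) (by linarith)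
    (by rwa [mul_div_cancel₀ _ (two_ne_zero' ℝ)]) T₁ hT₁ le_rfl
  have h3 := hmax _ _ (hw.glue ht0 hT₁ hz)
  rw [EReal.coe_le_coe_iff] at h3
  linarith [(le_max_right _ _).trans_lt htI.1]

end Main

theorem mainTheorem1 (n m : ℝ) (k : ℕ) (hk : 1 ≤ k) (R ε : ℝ) (hR : 0 < R) (hε : 0 < ε)
    (hε1 : ε ≤ 1) :
    -- local existence: the time depends only on the parameters and a lower bound `δ`
    -- for `R - ‖φ₀ - 1‖`
    (∀ δ : ℝ, 0 < δ → ∃ T₀ : ℝ, 0 < T₀ ∧ ∃ α : ℝ, 0 ≤ α ∧ α < 1 ∧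
      ∀ w₀ : SobolevH k, ‖w₀‖ ≤ R - δ → PorosityGe (2 * ε) w₀ →
      ∀ T : ℝ, 0 < T → T ≤ T₀ →
        -- `Λ` is well defined on `𝒳`
        (∀ w ∈ SpaceX k R ε T, ∀ t ∈ Icc (0 : ℝ) T,
          ∃ u : SobolevH 1, SolvesElliptic n m (porosity (w t)) u ∧
            IsPowTimes m (porosity (w t)) u (rate n m (w t)) ∧
            ∀ u' : SobolevH 1, SolvesElliptic n m (porosity (w t)) u' → u' = u) ∧
        -- `Λ` is a contraction of `𝒳`
        (∀ w ∈ SpaceX k R ε T, Lam n m w₀ w ∈ SpaceX k R ε T) ∧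
        (∀ w ∈ SpaceX k R ε T, ∀ v ∈ SpaceX k R ε T,
          supDist T (Lam n m w₀ w) (Lam n m w₀ v) ≤ α * supDist T w v) ∧
        -- its unique fixed point is the unique local solution
        ∃ w ∈ SpaceX k R ε T,
          EqOn (Lam n m w₀ w) w (Icc 0 T) ∧
          (∀ v ∈ SpaceX k R ε T, EqOn (Lam n m w₀ v) v (Icc 0 T) → EqOn v w (Icc 0 T)) ∧
          IsLocalSolution n m w₀ (T : EReal) w ∧
          ∀ v : ℝ → SobolevH k, IsLocalSolution n m w₀ (T : EReal) v →
            EqOn v w (timeInterval (T : EReal))) ∧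
    -- continuous dependence on the data
    (∃ C : ℝ, ∀ T : ℝ, 0 < T → ∀ (w₀ v₀ : SobolevH k) (w v : ℝ → SobolevH k),
      w ∈ SpaceX k R ε T → v ∈ SpaceX k R ε T →
      IsLocalSolution n m w₀ (T : EReal) w → IsLocalSolution n m v₀ (T : EReal) v →
      ∀ t ∈ timeInterval (T : EReal), ‖w t - v t‖ ≤ ‖w₀ - v₀‖ * Real.exp (C * t)) ∧
    -- maximal time of existence and blow-up alternative
    (∀ w₀ : SobolevH k, ‖w₀‖ < R → PorosityGe (2 * ε) w₀ →
      ∃ (Tmax : EReal) (w : ℝ → SobolevH k), 0 < Tmax ∧ IsLocalSolution n m w₀ Tmax w ∧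
        (∀ (T : EReal) (v : ℝ → SobolevH k), IsLocalSolution n m w₀ T v →
          T ≤ Tmax ∧ EqOn v w (timeInterval T)) ∧
        ∀ T : ℝ, Tmax = (T : EReal) →
          Tendsto (fun t : ℝ => ‖w t‖ₑ + eLpNorm (fun z => (porosity (w t) z)⁻¹) ∞ volume)
            (𝓝[<] T) (𝓝 ∞)) := by
  obtain ⟨k, rfl⟩ : ∃ j, k = j + 1 := ⟨k - 1, by omega⟩
  refine ⟨fun δ hδ => local_existence k n m R hε hδ, continuous_dependence k n m R hε,
    fun w₀ hR₀ hε₀ => ?_⟩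
  -- Here `δ = R - ‖w₀‖`.
  obtain ⟨T₁, hT₁, _, _, _, hloc⟩ := local_existence k n m R hε (sub_pos.2 hR₀)
  obtain ⟨-, -, -, z, -, -, -, hz, -⟩ := hloc w₀ (by linarith) hε₀ T₁ hT₁ le_rfl
  obtain ⟨Tmax, w, hpos, hw, hmax⟩ := exists_maximal_solution ⟨T₁, z, hT₁, hz⟩
  refine ⟨Tmax, w, hpos, hw, hmax, fun T hT => ?_⟩
  subst hT
  exact hw.blow_up (by exact_mod_cast hpos) fun S v hv => (hmax S v hv).1
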